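/- **Model.** Let $d,m\ge 2$, $\mathcal K=\{1,\dots,d\}$, $\mathcal J=\{1,\dots,m\}$. Let $Q=(q_{ij})$ be an irreducible transition rate matrix on $\mathcal J$ (nonnegative off-diagonal entries, zero row sums), let $\lambda_k(i)\ge 0$ and $\mu_k(i)\ge 0$ ($k\in\mathcal K$, $i\in\mathcal J$) be the exogenous input and potential release rates, and let $P=(p_{k,\ell})_{k,\ell\in\mathcal K}$ be a substochastic matrix. Assume that the matrix $\overline P$ on $\{0\}\cup\mathcal K$ with $p_{0,0}=0$, $p_{0,\ell}=\sum_i\lambda_\ell(i)/\sum_i\sum_k\lambda_k(i)$, $p_{k,0}=1-\sum_\ell p_{k,\ell}$ and the entries of $P$ elsewhere is irreducible. Put $v_k(i)=\lambda_k(i)+\sum_\ell\mu_\ell(i)p_{\ell,k}-\mu_k(i)$ and $R=I-P^{t}$. The Markov modulated fluid network process $X(t)=(Z(t),J(t))$, $t\ge0$, consists of a background process $J$, right-continuous with left limits, which is a Markov chain with transition rate matrix $Q$ with respect to the filtration generated by $X$, and of buffer contents $Z_k(t)\ge 0$. Together with the continuous cumulative releases $B_k(t)$, $B_k(0)=0$,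 these satisfy on every sample path $$Z_k(t)=Z_k(0)+\int_0^t\lambda_k(J(s))\,ds+\sum_\ell p_{\ell,k}B_\ell(t)-B_k(t),$$ where each $B_k$ is differentiable except at finitely many points of each finite time interval and, wherever the derivatives exist at times $t>0$, $B_k'(t)\le\mu_k(J(t))$, with equality if $Z_k(t)>0$, and $Z_k'(t)=0$ if $Z_k(t)=0$. The process $Y_k(t)=\int_0^t\mu_k(J(s))\,ds-B_k(t)$ is then continuous and nondecreasing. Let $\nu$ be a stationary distribution of $X$, and let $\mathbb E_\nu$ be the expectation for the process started from $\nu$ (so $X(t)\sim\nu$ for all $t\ge0$). Let $m_k=\mathbb E_\nu(Y_k(1))$, and let $\mathbb E_k$ be the Palm expectation with respect to $Y_k$, i.e. $\mathbb E_k(f(Z,J))=m_k^{-1}\,\mathbb E_\nu\big(\int_0^1 f(X(u))\,Y_k(du)\big)$ for $f\ge0$ (if $m_k=0$, the products $m_k\mathbb E_k(\cdot)$ below are $0$). **Transforms.** For $\theta\in\mathbb R^d$ let $K(\theta)=\mathrm{diag}\big(\sum_k\theta_kv_k(i)\big)_{i\in\mathcal J}+Q$, let $\gamma(\theta)$ be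 its Perron–Frobenius eigenvalue (the eigenvalue with the largest real part), and let $h_\theta$ be its positive right eigenvector for $\gamma(\theta)$, normalized by $\langle\xi_\theta,h_\theta\rangle=1$, $\langle\xi_\theta,\mathbf 1\rangle=1$, where $\xi_\theta$ is a left eigenvector for $\gamma(\theta)$. Let $\gamma_k(\theta)=[\theta^{t}R]_k$ and, for $A\subset\mathcal K$, $$\Gamma^-_A=\{\theta\in\mathbb R^d:\gamma(\theta)<0,\ \gamma_k(\theta)<0\ \text{for all } k\in A\}.$$ Define, with values in $[0,\infty]$, $$\varphi(\theta)=\mathbb E_\nu(e^{\langle\theta,Z\rangle}),\quad \varphi_k(\theta)=m_k\mathbb E_k(e^{\langle\theta,Z\rangle}),\quad \psi(\theta)=\mathbb E_\nu(e^{\langle\theta,Z\rangle}h_\theta(J)),\quad \psi_k(\theta)=m_k\mathbb E_k(e^{\langle\theta,Z\rangle}h_\theta(J)).$$ **Lemma.** Let $\theta\in\mathbb R^d$. Then $\varphi(\theta)<\infty$ if and only if $\psi(\theta)<\infty$, and, for each $k\in\mathcal K$, $\varphi_k(\theta)<\infty$ if and only if $\psi_k(\theta)<\infty$. Moreover: (a)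 If $\varphi(\theta)<\infty$, then $\varphi_k(\theta)<\infty$ and $\psi_k(\theta)<\infty$ for all $k\in\mathcal K$, and $$\gamma(\theta)\psi(\theta)+\sum_{k=1}^d\gamma_k(\theta)\psi_k(\theta)=0.\tag{1}$$ (b) Let $A\subset\mathcal K$ and $\theta\in\Gamma^-_{\mathcal K\setminus A}$. If $\varphi_k(\theta)<\infty$ for all $k\in A$, then $$(-\gamma(\theta))\psi(\theta)+\sum_{k\in\mathcal K\setminus A}(-\gamma_k(\theta))\psi_k(\theta)\le\sum_{k\in A}\gamma_k(\theta)\psi_k(\theta),$$ and therefore $\varphi(\theta)<\infty$, $\psi(\theta)<\infty$, $\varphi_k(\theta)<\infty$ and $\psi_k(\theta)<\infty$ for all $k\in\mathcal K\setminus A$, and (1) holds. -/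

import Mathlib

open MeasureTheory Set Filter Topology
open scoped ENNReal BigOperators Matrix

namespace MMFN

/-- Irreducibility of a square matrix with nonnegative off-diagonal entries (a transition
probability or a transition rate matrix): every index is reached from every other one along
positive entries. -/
def IsIrred {ι : Type*} (M : Matrix ι ι ℝ) : Prop :=
  ∀ i j, Relation.ReflTransGen (fun a b => 0 < M a b) i j

/-- The routing matrix with the outside world (index `none`) added.  The outside sends fluid to
station `l` in proportion to the exogenous input rates `lam l`, and receives from station `k` the
fraction `1 - ∑ l, P k l`. -/
noncomputable def augmentedRouting {d m : ℕ} (lam : Fin d → Fin m → ℝ)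
    (P : Matrix (Fin d) (Fin d) ℝ) : Matrix (Option (Fin d)) (Option (Fin d)) ℝ
  | none, none => 0
  | none, some l => (∑ i, lam l i) / ∑ i, ∑ k, lam k i
  | some k, none => 1 - ∑ l, P k l
  | some k, some l => P k l

/-- Modeling primitives of a Markov modulated fluid network with `d` stations and `m` background
states. -/
structure Network (d m : ℕ) where
  /-- transition rate matrix of the background Markov chain -/
  Q : Matrix (Fin m) (Fin m) ℝ
  /-- `lam k i`: exogenous input rate at station `k` in background state `i` -/
  lam : Fin d → Fin m → ℝ
  /-- `mu k i`: potential release rate of station `k` in background state `i` -/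
  mu : Fin d → Fin m → ℝ
  /-- `P k l`: fraction of the fluid released at station `k` that is sent to station `l` -/
  P : Matrix (Fin d) (Fin d) ℝ
  Q_nonneg : ∀ i j, i ≠ j → 0 ≤ Q i j
  Q_row : ∀ i, ∑ j, Q i j = 0
  Q_irred : IsIrred Q
  lam_nonneg : ∀ k i, 0 ≤ lam k i
  mu_nonneg : ∀ k i, 0 ≤ mu k i
  P_nonneg : ∀ k l, 0 ≤ P k l
  P_row : ∀ k, ∑ l, P k l ≤ 1
  P_irred : IsIrred (augmentedRouting lam P)

/-! ### Spectral quantities -/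

/-- The largest real part of an eigenvalue of `M`.  For an irreducible matrix with nonnegative
off-diagonal entries this is the Perron-Frobenius eigenvalue. -/
noncomputable def perronRoot {m : ℕ} (M : Matrix (Fin m) (Fin m) ℝ) : ℝ :=
  sSup (Complex.re '' spectrum ℂ (M.map (fun x : ℝ => (x : ℂ))))

/-- `h` is the positive right eigenvector of `M` for the Perron-Frobenius eigenvalue, normalized
by `⟨ξ, h⟩ = 1` and `⟨ξ, 1⟩ = 1`, where `ξ` is a left eigenvector for the same eigenvalue. -/
def IsPerronVec {m : ℕ} (M : Matrix (Fin m) (Fin m) ℝ) (h : Fin m → ℝ) : Prop :=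
  (∀ i, 0 < h i) ∧ M *ᵥ h = perronRoot M • h ∧
    ∃ ξ : Fin m → ℝ, ξ ᵥ* M = perronRoot M • ξ ∧ ξ ⬝ᵥ h = 1 ∧ ∑ i, ξ i = 1

/-- The normalized positive right Perron-Frobenius eigenvector. -/
noncomputable def perronVec {m : ℕ} (M : Matrix (Fin m) (Fin m) ℝ) : Fin m → ℝ :=
  Classical.epsilon (IsPerronVec M)

namespace Network

variable {d m : ℕ} (N : Network d m)

/-- Net flow rate of station `k` in background state `i` when no buffer is empty. -/
noncomputable def v (k : Fin d) (i : Fin m) : ℝ :=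
  N.lam k i + ∑ l, N.mu l i * N.P l k - N.mu k i

/-- The reflection matrix `R = I - Pᵗ`. -/
noncomputable def R : Matrix (Fin d) (Fin d) ℝ := 1 - N.Pᵀ

/-- `K(θ) = diag(∑ₖ θₖ vₖ) + Q`. -/
noncomputable def K (θ : Fin d → ℝ) : Matrix (Fin m) (Fin m) ℝ :=
  Matrix.diagonal (fun i => ∑ k, θ k * N.v k i) + N.Q

/-- `γ(θ)`, the Perron-Frobenius eigenvalue of `K(θ)`. -/
noncomputable def gam (θ : Fin d → ℝ) : ℝ := perronRoot (N.K θ)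

/-- `h_θ`, the normalized positive right eigenvector of `K(θ)` for `γ(θ)`. -/
noncomputable def hvec (θ : Fin d → ℝ) : Fin m → ℝ := perronVec (N.K θ)

/-- `γₖ(θ) = [θᵗ R]ₖ`. -/
noncomputable def gamK (k : Fin d) (θ : Fin d → ℝ) : ℝ := (θ ᵥ* N.R) k

/-- `Γ⁻_A = {θ : γ(θ) < 0 and γₖ(θ) < 0 for all k ∈ A}`. -/
def GammaMinus (A : Finset (Fin d)) : Set (Fin d → ℝ) :=
  {θ | N.gam θ < 0 ∧ ∀ k ∈ A, N.gamK k θ < 0}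

end Network

/-! ### The process -/

/-- The history `σ(X(u) ; 0 ≤ u ≤ t)` of a process `X` indexed by time `t ≥ 0`. -/
@[reducible] def history {Ω E : Type*} [MeasurableSpace E] (X : ℝ → Ω → E) (t : ℝ) : MeasurableSpace Ω :=
  ⨆ u ∈ Icc (0 : ℝ) t, MeasurableSpace.comap (X u) inferInstance

/-- A Markov modulated fluid network process on a probability space, with primitives `N`:
background state `J`, buffer contents `Z`, cumulative released fluid `B`.  The time parameter is
real and only times `t ≥ 0` matter. -/
structure FluidProcess {d m : ℕ} (N : Network d m) {Ω : Type*} [MeasurableSpace Ω]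
    (ℙ : Measure Ω) where
  /-- background state -/
  J : ℝ → Ω → Fin m
  /-- buffer contents -/
  Z : ℝ → Ω → Fin d → ℝ
  /-- cumulative amount of released fluid -/
  B : ℝ → Ω → Fin d → ℝ
  J_meas : ∀ t, 0 ≤ t → Measurable (J t)
  Z_meas : ∀ t, 0 ≤ t → Measurable (Z t)
  B_meas : ∀ t, 0 ≤ t → Measurable (B t)
  /-- `J` is right-continuous -/
  J_right : ∀ ω t, 0 ≤ t → ∀ᶠ u in 𝓝[>] t, J u ω = J t ω
  /-- `J` has left limits -/
  J_left : ∀ ω t, 0 < t → ∃ j, ∀ᶠ u in 𝓝[<] t, J u ω = j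
  /-- `J` is a Markov chain with transition rate matrix `Q` with respect to the history of
  `(Z, J)`: its transition matrix over a time span `s` is `exp(sQ)`. -/
  J_markov : ∀ s t, 0 ≤ s → 0 ≤ t → ∀ j : Fin m,
    ℙ[(J (t + s) ⁻¹' {j}).indicator (fun _ => (1 : ℝ)) |
        history (fun u ω => (Z u ω, J u ω)) t]
      =ᵐ[ℙ] fun ω => NormedSpace.exp (s • N.Q) (J t ω) j
  Z_nonneg : ∀ ω t, 0 ≤ t → ∀ k, 0 ≤ Z t ω k
  B_zero : ∀ ω k, B 0 ω k = 0
  B_cont : ∀ ω k, ContinuousOn (fun t => B t ω k) (Ici 0)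
  /-- flow balance -/
  balance : ∀ ω t, 0 ≤ t → ∀ k,
    Z t ω k = Z 0 ω k + (∫ u in (0 : ℝ)..t, N.lam k (J u ω)) + ∑ l, N.P l k * B t ω l - B t ω k
  /-- `Bₖ` is differentiable except at finitely many points of each finite time interval -/
  B_diff : ∀ ω k T, {t ∈ Ioo (0 : ℝ) T | ¬ DifferentiableAt ℝ (fun s => B s ω k) t}.Finite
  /-- a station never releases faster than its potential release rate -/
  B_le : ∀ ω t, 0 < t → ∀ k, DifferentiableAt ℝ (fun s => B s ω k) t →
    deriv (fun s => B s ω k) t ≤ N.mu k (J t ω)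
  /-- a station with a nonempty buffer releases at its potential release rate -/
  B_eq : ∀ ω t, 0 < t → ∀ k, DifferentiableAt ℝ (fun s => B s ω k) t → 0 < Z t ω k →
    deriv (fun s => B s ω k) t = N.mu k (J t ω)
  /-- an empty buffer has zero rate of change -/
  Z_deriv : ∀ ω t, 0 < t → ∀ k, DifferentiableAt ℝ (fun s => Z s ω k) t → Z t ω k = 0 →
    deriv (fun s => Z s ω k) t = 0

namespace FluidProcess

variable {d m : ℕ} {N : Network d m} {Ω : Type*} [MeasurableSpace Ω] {ℙ : Measure Ω}
  (X : FluidProcess N ℙ)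

/-- The state `X(t) = (Z(t), J(t))`. -/
def state (t : ℝ) (ω : Ω) : (Fin d → ℝ) × Fin m := (X.Z t ω, X.J t ω)

/-- `ν` is a stationary distribution and `X` is started from it: `X(t)` has law `ν` for all
`t ≥ 0`. -/
def IsStationary (ν : Measure ((Fin d → ℝ) × Fin m)) : Prop :=
  ∀ t, 0 ≤ t → ℙ.map (X.state t) = ν

/-- `Yₖ(t) = ∫₀ᵗ μₖ(J(s)) ds - Bₖ(t)`. -/
noncomputable def Y (k : Fin d) (t : ℝ) (ω : Ω) : ℝ :=
  (∫ u in (0 : ℝ)..t, N.mu k (X.J u ω)) - X.B t ω k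

lemma integrable_mu (k : Fin d) (ω : Ω) {a b : ℝ} (ha : 0 ≤ a) :
    IntegrableOn (fun u => N.mu k (X.J u ω)) (Icc a b) := by
  have hm : Measurable (fun u => X.J (max u 0) ω) := by
    refine measurable_to_countable' fun j => MeasurableSet.of_mem_nhdsGT fun x hx => ?_
    rcases lt_or_ge x 0 with h | h
    · have h1 : ∀ᶠ u in 𝓝[>] x, u < 0 := nhdsWithin_le_nhds (Iio_mem_nhds h)
      filter_upwards [h1] with u hu
      simp only [mem_preimage, mem_singleton_iff] at hx ⊢
      rw [max_eq_right hu.le]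
      rwa [max_eq_right h.le] at hx
    · filter_upwards [X.J_right ω x h, self_mem_nhdsWithin] with u hu hxu
      simp only [mem_preimage, mem_singleton_iff] at hx ⊢
      have hxu' : x < u := hxu
      rw [max_eq_left (h.trans hxu'.le), hu]
      rwa [max_eq_left h] at hx
  have hi : IntegrableOn (fun u => N.mu k (X.J (max u 0) ω)) (Icc a b) := by
    refine Measure.integrableOn_of_bounded (M := ∑ i, |N.mu k i|) (by simp)
      (Measurable.aestronglyMeasurable ((measurable_of_countable (N.mu k)).comp hm)) ?_
    refine Eventually.of_forall fun u => ?_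
    exact Finset.single_le_sum (f := fun i => |N.mu k i|) (fun i _ => abs_nonneg _)
      (Finset.mem_univ _)
  refine hi.congr_fun (fun u hu => ?_) measurableSet_Icc
  simp only [max_eq_left (ha.trans hu.1)]

lemma B_sub_le (k : Fin d) (ω : Ω) (F : Finset ℝ) :
    ∀ a b : ℝ, 0 ≤ a → a ≤ b →
      (∀ t ∈ Ioo a b, t ∉ F → DifferentiableAt ℝ (fun s => X.B s ω k) t) →
      X.B b ω k - X.B a ω k ≤ ∫ u in a..b, N.mu k (X.J u ω) := by
  classical
  have hii : ∀ a b : ℝ, 0 ≤ a → a ≤ b →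
      IntervalIntegrable (fun u => N.mu k (X.J u ω)) volume a b := fun a b ha hab =>
    (intervalIntegrable_iff_integrableOn_Icc_of_le hab).2 (X.integrable_mu k ω ha)
  induction F using Finset.induction_on with
  | empty =>
    intro a b ha hab hd
    refine intervalIntegral.sub_le_integral_of_hasDeriv_right_of_le
      (g := fun s => X.B s ω k) (g' := fun t => deriv (fun s => X.B s ω k) t) hab
      ((X.B_cont ω k).mono fun t ht => ha.trans ht.1)
      (fun t ht => (hd t ht (by simp)).hasDerivAt.hasDerivWithinAt)
      (X.integrable_mu k ω ha)
      (fun t ht => X.B_le ω t (ha.trans_lt ht.1) k (hd t ht (by simp)))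
  | insert c F _ ih =>
    intro a b ha hab hd
    by_cases hc : c ∈ Ioo a b
    · have h1 := ih a c ha hc.1.le fun t ht htF =>
        hd t ⟨ht.1, ht.2.trans hc.2⟩ (by simp [htF, ht.2.ne])
      have h2 := ih c b (ha.trans hc.1.le) hc.2.le fun t ht htF =>
        hd t ⟨hc.1.trans ht.1, ht.2⟩ (by simp [htF, ht.1.ne'])
      have h3 := intervalIntegral.integral_add_adjacent_intervals
        (hii a c ha hc.1.le) (hii c b (ha.trans hc.1.le) hc.2.le)
      linarith
    · refine ih a b ha hab fun t ht htF => hd t ht ?_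
      have : t ≠ c := fun h => hc (h ▸ ht)
      simp [htF, this]

lemma Y_sub (k : Fin d) (ω : Ω) {a b : ℝ} (ha : 0 ≤ a) (hab : a ≤ b) :
    X.Y k b ω - X.Y k a ω = (∫ u in a..b, N.mu k (X.J u ω)) - (X.B b ω k - X.B a ω k) := by
  have h := intervalIntegral.integral_add_adjacent_intervals (μ := volume)
    ((intervalIntegrable_iff_integrableOn_Icc_of_le ha).2 (X.integrable_mu k ω le_rfl))
    ((intervalIntegrable_iff_integrableOn_Icc_of_le hab).2 (X.integrable_mu k ω ha))
  unfold Y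
  linarith

lemma Y_mono (k : Fin d) (ω : Ω) : Monotone (fun t => X.Y k (max t 0) ω) := by
  intro s t hst
  have h0 : (0 : ℝ) ≤ max s 0 := le_max_right _ _
  have hle : max s 0 ≤ max t 0 := max_le_max_right 0 hst
  have hF := X.B_diff ω k (max t 0)
  have h := X.B_sub_le k ω hF.toFinset (max s 0) (max t 0) h0 hle fun u hu hn => by
    by_contra hcon
    exact hn (by simpa using ⟨⟨h0.trans_lt hu.1, lt_max_iff.1 hu.2⟩, hcon⟩)
  have h2 := X.Y_sub k ω h0 hle
  simp only
  linarith

lemma Y_cont (k : Fin d) (ω : Ω) : Continuous (fun t => X.Y k (max t 0) ω) := by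
  have hB : Continuous (fun t => X.B (max t 0) ω k) :=
    (X.B_cont ω k).comp_continuous (by fun_prop) fun t => le_max_right t 0
  have hI : ContinuousOn (fun t => ∫ u in (0 : ℝ)..t, N.mu k (X.J u ω)) (Ici 0) := by
    intro t ht
    have ht' : (0 : ℝ) ≤ t := ht
    have h := intervalIntegral.continuousOn_primitive_interval (μ := volume) (a := 0) (b := t + 1)
      (f := fun u => N.mu k (X.J u ω))
      (by rw [uIcc_of_le (by linarith)]; exact X.integrable_mu k ω le_rfl)
    rw [uIcc_of_le (by linarith)] at h
    refine (h t ⟨ht', by linarith⟩).mono_of_mem_nhdsWithin ?_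
    rw [← Ici_inter_Iic]
    exact inter_mem self_mem_nhdsWithin (nhdsWithin_le_nhds (Iic_mem_nhds (by linarith)))
  exact (hI.comp_continuous (by fun_prop) fun t => le_max_right t 0).sub hB

/-- The random measure `Yₖ(du)` on `[0, ∞)`: the Lebesgue-Stieltjes measure of the continuous
nondecreasing function `Yₖ`. -/
noncomputable def dY (k : Fin d) (ω : Ω) : Measure ℝ :=
  (StieltjesFunction.mk (fun t => X.Y k (max t 0) ω) (X.Y_mono k ω)
    fun _ => (X.Y_cont k ω).continuousWithinAt).measure

/-- `mₖ = E(Yₖ(1))`. -/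
noncomputable def mass (k : Fin d) : ℝ≥0∞ := ∫⁻ ω, ENNReal.ofReal (X.Y k 1 ω) ∂ℙ

/-- Expectation of `f(X(0))` under the Palm distribution with respect to `Yₖ`:
`Eₖ(f(X(0))) = mₖ⁻¹ E(∫₀¹ f(X(u)) Yₖ(du))`. -/
noncomputable def palmExp (k : Fin d) (f : (Fin d → ℝ) × Fin m → ℝ≥0∞) : ℝ≥0∞ :=
  (X.mass k)⁻¹ * ∫⁻ ω, ∫⁻ u in Ioc (0 : ℝ) 1, f (X.state u ω) ∂(X.dY k ω) ∂ℙ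

/-- `φₖ(θ) = mₖ Eₖ(e^{⟨θ, Z⟩})`. -/
noncomputable def phiK (k : Fin d) (θ : Fin d → ℝ) : ℝ≥0∞ :=
  X.mass k * X.palmExp k fun x => ENNReal.ofReal (Real.exp (θ ⬝ᵥ x.1))

/-- `ψₖ(θ) = mₖ Eₖ(e^{⟨θ, Z⟩} h_θ(J))`. -/
noncomputable def psiK (k : Fin d) (θ : Fin d → ℝ) : ℝ≥0∞ :=
  X.mass k * X.palmExp k fun x => ENNReal.ofReal (Real.exp (θ ⬝ᵥ x.1) * N.hvec θ x.2)

end FluidProcess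

/-- `φ(θ) = E_ν(e^{⟨θ, Z⟩})`. -/
noncomputable def phi {d m : ℕ} (ν : Measure ((Fin d → ℝ) × Fin m)) (θ : Fin d → ℝ) : ℝ≥0∞ :=
  ∫⁻ x, ENNReal.ofReal (Real.exp (θ ⬝ᵥ x.1)) ∂ν

/-- `ψ(θ) = E_ν(e^{⟨θ, Z⟩} h_θ(J))`. -/
noncomputable def psi {d m : ℕ} (N : Network d m) (ν : Measure ((Fin d → ℝ) × Fin m))
    (θ : Fin d → ℝ) : ℝ≥0∞ :=
  ∫⁻ x, ENNReal.ofReal (Real.exp (θ ⬝ᵥ x.1) * N.hvec θ x.2) ∂ν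

end MMFN

/-! # Transforms of the stationary distribution of a Markov modulated fluid network

Write `F = e^{⟨θ, Z⟩} h_θ(J)`.  In stationarity the expectation of `g (J(t), ⟨θ, Z(t)⟩)` does not
depend on `t`, and splitting its change over `[0, 1]` into the contributions of the jumps of `J`, of
the free drift of `Z` and of the reflection terms `Yₖ` gives the basic adjoint relationship
`IsStationary.basic_adjoint`:
`E_ν (∑ⱼ Q(J, j) g(j, ⟨θ, Z⟩) + ⟨θ, v(J)⟩ ∂g(J, ⟨θ, Z⟩)) + ∑ₖ γₖ(θ) E ∫₀¹ ∂g(J, ⟨θ, Z⟩) dYₖ = 0`,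
valid as soon as `g` and its derivative `∂g` in the second variable are dominated by a function of
`⟨θ, Z⟩` that is integrable under `ν`.  No stochastic calculus is needed: on a grid of mesh `1 / n`
the change of `J` is evaluated with `exp (Q / n)` by the Markov property (`integral_markov`), the
change of `Z` with the change of variables formula on each path (`comp_lin_sub`), with `J` frozen at
the next grid point; as `n → ∞` the frozen value tends to the current one because `J` is
right-continuous (`tendsto_integral_gridUp`).  The domination on the boundary comes for free: the
release rates lie between `0` and the potential rates, because a set of stations with negative rates
would be closed under routing (`release_nonneg`); hence `Yₖ(du)` has a bounded density
(`dY_eq_withDensity`), and by stationarity integrals over the Palm measures are bounded by integrals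
over `ν` (`lintegral_compProd_le`).

Part (a) is the basic adjoint relationship for `g = F`, since `K(θ) h_θ = γ(θ) h_θ`.  For part (b)
it is applied to the bounded functions `c F / (c + F)`.  As `x ↦ c x / (c + x)` is concave, the
interior term is at most `γ(θ) E_ν (F c² / (c + F)²)` (`drift_saturation_le`), so that
`-γ(θ) E_ν (F c² / (c + F)²) ≤ ∑_{k ∈ A} |γₖ(θ)| ψₖ(θ)` for every `c > 0`.  Fatou's lemma for `c → ∞`
shows that `ψ(θ)` is finite, and part (a) then yields the remaining claims.

Existence, positivity and normalization of `h_θ` are the Perron-Frobenius theorem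
(`exists_isPerronVec`), proved by the Collatz-Wielandt maximum principle. -/

namespace MMFN

/-! ### The Perron-Frobenius eigenvector -/

lemma mulVec_pos {ι : Type*} [Fintype ι] {B : Matrix ι ι ℝ} (hB : ∀ i j, 0 < B i j)
    {w : ι → ℝ} (hw : ∀ i, 0 ≤ w i) (hne : w ≠ 0) (i : ι) : 0 < (B *ᵥ w) i := by
  obtain ⟨j, hj⟩ := Function.ne_iff.1 hne
  refine Finset.sum_pos' (fun k _ => mul_nonneg (hB i k).le (hw k)) ⟨j, Finset.mem_univ _, ?_⟩
  exact mul_pos (hB i j) (lt_of_le_of_ne (hw j) (Ne.symm hj))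

lemma IsIrred.transpose {ι : Type*} {M : Matrix ι ι ℝ} (hM : IsIrred M) : IsIrred Mᵀ := fun i j =>
  Relation.reflTransGen_swap.1 (hM j i)

section Perron

variable {ι : Type*} [Fintype ι] [DecidableEq ι]

/-- A nonnegative irreducible matrix with positive diagonal has a power with positive entries. -/
lemma exists_pow_pos {M : Matrix ι ι ℝ} (h0 : ∀ i j, 0 ≤ M i j) (hd : ∀ i, 0 < M i i)
    (hM : IsIrred M) : ∃ n : ℕ, ∀ i j, 0 < (M ^ n) i j := by
  have hn : ∀ n : ℕ, ∀ i j, 0 ≤ (M ^ n) i j := by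
    intro n
    induction n with
    | zero => intro i j; rw [pow_zero, Matrix.one_apply]; split_ifs <;> norm_num
    | succ n ih =>
      intro i j
      rw [pow_succ, Matrix.mul_apply]
      exact Finset.sum_nonneg fun k _ => mul_nonneg (ih i k) (h0 k j)
  have hstep : ∀ (n : ℕ) (i b c : ι), 0 < (M ^ n) i b → 0 < M b c → 0 < (M ^ (n + 1)) i c := by
    intro n i b c h1 h2
    rw [pow_succ, Matrix.mul_apply]
    exact (mul_pos h1 h2).trans_le (Finset.single_le_sum
      (f := fun k => (M ^ n) i k * M k c) (fun k _ => mul_nonneg (hn n i k) (h0 k c))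
      (Finset.mem_univ b))
  have hex : ∀ p : ι × ι, ∃ n : ℕ, 0 < (M ^ n) p.1 p.2 := by
    rintro ⟨i, j⟩
    induction hM i j with
    | refl => exact ⟨0, by simp⟩
    | tail _ hbc ih =>
      obtain ⟨n, hn⟩ := ih
      exact ⟨n + 1, hstep n _ _ _ hn hbc⟩
  choose f hf using hex
  have hmono : ∀ (i j : ι) (n k : ℕ), 0 < (M ^ n) i j → 0 < (M ^ (n + k)) i j := by
    intro i j n k h
    induction k with
    | zero => exact h
    | succ k ih => exact hstep _ _ _ _ ih (hd j)
  refine ⟨∑ p, f p, fun i j => ?_⟩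
  obtain ⟨k, hk⟩ := Nat.exists_eq_add_of_le
    (Finset.single_le_sum (f := f) (fun p _ => Nat.zero_le _) (Finset.mem_univ (i, j)))
  rw [hk]
  exact hmono _ _ _ _ (hf (i, j))

/-- A nonnegative matrix with a positive power has a positive eigenvector.  The eigenvalue is the
largest `r` with `r x ≤ M x` for some `x` in the simplex; at a maximizer, `M x = r x`, since
otherwise `M ^ n` turns `r x ≤ M x` into a strict inequality. -/
lemma exists_pos_eigenvector [Nonempty ι] {M : Matrix ι ι ℝ} (h0 : ∀ i j, 0 ≤ M i j)
    {n : ℕ} (hn : ∀ i j, 0 < (M ^ n) i j) :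
    ∃ (r : ℝ) (x : ι → ℝ), (∀ i, 0 < x i) ∧ M *ᵥ x = r • x := by
  set T : Set (ℝ × (ι → ℝ)) :=
    {p | p.2 ∈ stdSimplex ℝ ι ∧ 0 ≤ p.1 ∧ ∀ i, p.1 * p.2 i ≤ (M *ᵥ p.2) i} with hT
  have hcont : Continuous fun p : ℝ × (ι → ℝ) => M *ᵥ p.2 :=
    Continuous.matrix_mulVec continuous_const continuous_snd
  have hclosed : IsClosed T := by
    refine IsClosed.inter ((isClosed_stdSimplex ℝ ι).preimage continuous_snd)
      (IsClosed.inter (isClosed_le continuous_const continuous_fst) ?_)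
    have hset : {p : ℝ × (ι → ℝ) | ∀ i, p.1 * p.2 i ≤ (M *ᵥ p.2) i} =
        ⋂ i, {p : ℝ × (ι → ℝ) | p.1 * p.2 i ≤ (M *ᵥ p.2) i} := by
      ext p; simp
    change IsClosed {p : ℝ × (ι → ℝ) | ∀ i, p.1 * p.2 i ≤ (M *ᵥ p.2) i}
    rw [hset]
    refine isClosed_iInter fun i => isClosed_le ?_ ?_
    · exact continuous_fst.mul ((continuous_apply i).comp continuous_snd)
    · exact (continuous_apply i).comp hcont
  have hsub : T ⊆ Icc 0 (∑ i, ∑ j, M i j) ×ˢ stdSimplex ℝ ι := by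
    rintro ⟨r, x⟩ ⟨hx, hr, hle⟩
    refine ⟨⟨hr, ?_⟩, hx⟩
    have h1 : r = ∑ i, r * x i := by rw [← Finset.mul_sum, hx.2, mul_one]
    rw [h1]
    refine Finset.sum_le_sum fun i _ => (hle i).trans (Finset.sum_le_sum fun j _ => ?_)
    exact mul_le_of_le_one_right (h0 i j)
      (hx.2 ▸ Finset.single_le_sum (f := x) (fun k _ => hx.1 k) (Finset.mem_univ j))
  have hcomp : IsCompact T :=
    (isCompact_Icc.prod (isCompact_stdSimplex ℝ ι)).of_isClosed_subset hclosed hsub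
  have hne : T.Nonempty := by
    obtain ⟨i⟩ := ‹Nonempty ι›
    refine ⟨(0, Pi.single i 1), single_mem_stdSimplex ℝ i, le_rfl, fun j => ?_⟩
    simpa using h0 j i
  obtain ⟨⟨r, x⟩, ⟨hx, hr, hle⟩, hmax⟩ := hcomp.exists_isMaxOn hne continuous_fst.continuousOn
  simp only at hx hr hle
  have hx0 : x ≠ 0 := by
    rintro rfl
    simpa using hx.2
  have hy : ∀ i, 0 < ((M ^ n) *ᵥ x) i := mulVec_pos hn hx.1 hx0
  have hMx : M *ᵥ x = r • x := by
    by_contra hcon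
    set w : ι → ℝ := M *ᵥ x - r • x with hw
    have hw0 : ∀ i, 0 ≤ w i := fun i => by
      simpa [hw] using hle i
    have hBw := mulVec_pos hn hw0 (sub_ne_zero.2 hcon)
    set y := (M ^ n) *ᵥ x with hydef
    have hyw : M *ᵥ y = r • y + (M ^ n) *ᵥ w := by
      rw [hw, Matrix.mulVec_sub, Matrix.mulVec_smul, hydef, Matrix.mulVec_mulVec,
        Matrix.mulVec_mulVec, ← pow_succ', ← pow_succ]
      abel
    -- the largest improvement of `r` that the strict inequality for `y` allows
    obtain ⟨i₀, hi₀⟩ := Finite.exists_min fun i => ((M ^ n) *ᵥ w) i / y i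
    set ε := ((M ^ n) *ᵥ w) i₀ / y i₀ with hε
    have hεpos : 0 < ε := div_pos (hBw i₀) (hy i₀)
    have hs : 0 < ∑ i, y i := Finset.sum_pos (fun i _ => hy i) Finset.univ_nonempty
    have hmem : (r + ε, (∑ i, y i)⁻¹ • y) ∈ T := by
      refine ⟨⟨fun i => ?_, ?_⟩, by positivity, fun i => ?_⟩
      · exact mul_nonneg (inv_nonneg.2 hs.le) (hy i).le
      · simp only [Pi.smul_apply, smul_eq_mul]
        rw [← Finset.mul_sum, inv_mul_cancel₀ hs.ne']
      · have h1 : ε * y i ≤ ((M ^ n) *ᵥ w) i := (le_div_iff₀ (hy i)).1 (hi₀ i)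
        have h2 : (r + ε) * y i ≤ (M *ᵥ y) i := by
          rw [hyw]
          simp only [Pi.add_apply, Pi.smul_apply, smul_eq_mul]
          linarith
        simp only [Matrix.mulVec_smul, Pi.smul_apply, smul_eq_mul]
        rw [mul_left_comm]
        exact mul_le_mul_of_nonneg_left h2 (inv_nonneg.2 hs.le)
    have := hmax hmem
    simp only [mem_ofPred_eq] at this
    linarith
  refine ⟨r, x, fun i => lt_of_le_of_ne (hx.1 i) fun h => ?_, hMx⟩
  have hpow : ∀ k : ℕ, (M ^ k) *ᵥ x = r ^ k • x := by
    intro k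
    induction k with
    | zero => simp
    | succ k ih => rw [pow_succ, ← Matrix.mulVec_mulVec, hMx, Matrix.mulVec_smul, ih, smul_smul,
        pow_succ']
  have := hy i
  rw [hpow] at this
  simp [← h] at this

/-- An eigenvalue of `M` with a positive left eigenvector dominates the real parts of all
eigenvalues of `M`, when the off-diagonal entries of `M` are nonnegative. -/
lemma re_le_of_mem_spectrum {M : Matrix ι ι ℝ} {c r : ℝ} (h0 : ∀ i j, 0 ≤ (M + c • 1) i j)
    {ξ : ι → ℝ} (hξ : ∀ i, 0 < ξ i) (hξM : ξ ᵥ* M = r • ξ) {z : ℂ}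
    (hz : z ∈ spectrum ℂ (M.map (fun x : ℝ => (x : ℂ)))) : z.re ≤ r := by
  rw [← Matrix.spectrum_toLin', ← Module.End.hasEigenvalue_iff_mem_spectrum] at hz
  obtain ⟨x, hx⟩ := hz.exists_hasEigenvector
  have hx1 : ∀ i, ∑ j, (M i j : ℂ) * x j = z * x i := fun i => by
    have := congrFun hx.apply_eq_smul i
    simpa [Matrix.mulVec, dotProduct] using this
  have hx2 : ∀ i, ‖z + c‖ * ‖x i‖ ≤ ∑ j, (M + c • 1) i j * ‖x j‖ := by
    intro i
    have h1 : (z + c) * x i = ∑ j, (((M + c • 1) i j : ℝ) : ℂ) * x j := by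
      simp [Matrix.add_apply, Matrix.smul_apply, Matrix.one_apply, add_mul,
        Finset.sum_add_distrib, hx1, apply_ite ((↑) : ℝ → ℂ)]
    rw [← norm_mul, h1]
    refine (norm_sum_le _ _).trans (Finset.sum_le_sum fun j _ => ?_)
    rw [norm_mul, Complex.norm_real, Real.norm_of_nonneg (h0 i j)]
  have hM : ∀ j, ∑ i, ξ i * (M + c • 1) i j = (r + c) * ξ j := by
    intro j
    have := congrFun hξM j
    simp only [Matrix.vecMul, dotProduct, Pi.smul_apply, smul_eq_mul] at this
    simp [Matrix.add_apply, Matrix.smul_apply, Matrix.one_apply, mul_add,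
      Finset.sum_add_distrib, this]
    ring
  have hsum : ‖z + c‖ * ∑ i, ξ i * ‖x i‖ ≤ (r + c) * ∑ i, ξ i * ‖x i‖ := by
    calc ‖z + c‖ * ∑ i, ξ i * ‖x i‖ = ∑ i, ξ i * (‖z + c‖ * ‖x i‖) := by
          rw [Finset.mul_sum]; exact Finset.sum_congr rfl fun i _ => by ring
      _ ≤ ∑ i, ξ i * ∑ j, (M + c • 1) i j * ‖x j‖ :=
          Finset.sum_le_sum fun i _ => mul_le_mul_of_nonneg_left (hx2 i) (hξ i).le
      _ = ∑ j, (∑ i, ξ i * (M + c • 1) i j) * ‖x j‖ := by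
          simp_rw [Finset.mul_sum, Finset.sum_mul]
          rw [Finset.sum_comm]
          exact Finset.sum_congr rfl fun i _ => Finset.sum_congr rfl fun j _ => by ring
      _ = (r + c) * ∑ i, ξ i * ‖x i‖ := by
          simp_rw [hM, Finset.mul_sum]
          exact Finset.sum_congr rfl fun i _ => by ring
  have hpos : 0 < ∑ i, ξ i * ‖x i‖ := by
    obtain ⟨j, hj⟩ := Function.ne_iff.1 hx.2
    exact Finset.sum_pos' (fun i _ => mul_nonneg (hξ i).le (norm_nonneg _))
      ⟨j, Finset.mem_univ _, mul_pos (hξ j) (norm_pos_iff.2 hj)⟩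
  have h1 := le_of_mul_le_mul_right hsum hpos
  have h2 := Complex.re_le_norm (z + c)
  simp at h2
  linarith

end Perron

/-- The Perron-Frobenius theorem: the normalized positive eigenvector exists. -/
lemma exists_isPerronVec {m : ℕ} (hm : 0 < m) {M : Matrix (Fin m) (Fin m) ℝ}
    (h0 : ∀ i j, i ≠ j → 0 ≤ M i j) (hM : IsIrred M) : ∃ h, IsPerronVec M h := by
  have : Nonempty (Fin m) := ⟨⟨0, hm⟩⟩
  -- adding `c` on the diagonal makes the matrix nonnegative
  set c : ℝ := 1 + ∑ i, |M i i| with hc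
  have hdiag : ∀ i, 0 < (M + c • 1) i i := fun i => by
    have h1 : |M i i| ≤ ∑ i, |M i i| := Finset.single_le_sum (f := fun i => |M i i|) (fun i _ => abs_nonneg _)
      (Finset.mem_univ i)
    have h2 := neg_abs_le (M i i)
    simp only [Matrix.add_apply, Matrix.smul_apply, Matrix.one_apply_eq, smul_eq_mul, mul_one]
    linarith
  have hoff : ∀ i j, i ≠ j → (M + c • 1) i j = M i j := fun i j hij => by
    simp [Matrix.one_apply_ne hij]
  have hnn : ∀ i j, 0 ≤ (M + c • 1) i j := fun i j => by
    rcases eq_or_ne i j with rfl | hij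
    · exact (hdiag i).le
    · rw [hoff i j hij]; exact h0 i j hij
  have hnnt : ∀ i j, 0 ≤ (M + c • 1)ᵀ i j := fun i j => by
    rw [Matrix.transpose_apply]; exact hnn j i
  have hirr : IsIrred (M + c • 1) := fun i j =>
    Relation.ReflTransGen.mono (p := fun a b => 0 < (M + c • 1) a b)
      (fun a b (hab : 0 < M a b) => by
      show 0 < (M + c • 1) a b
      rcases eq_or_ne a b with rfl | h
      · exact hdiag a
      · rw [hoff a b h]; exact hab) i j (hM i j)
  obtain ⟨n, hn⟩ := exists_pow_pos hnn hdiag hirr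
  obtain ⟨n', hn'⟩ := exists_pow_pos (M := (M + c • 1)ᵀ) hnnt hdiag hirr.transpose
  obtain ⟨r, h, hpos, hr⟩ := exists_pos_eigenvector hnn hn
  obtain ⟨r', ξ, ξpos, hr'⟩ := exists_pos_eigenvector (M := (M + c • 1)ᵀ) hnnt hn'
  have hMh : M *ᵥ h = (r - c) • h := by
    rw [Matrix.add_mulVec, Matrix.smul_mulVec, Matrix.one_mulVec] at hr
    rw [sub_smul, ← hr, add_sub_cancel_right]
  have hξM : ξ ᵥ* M = (r' - c) • ξ := by
    rw [Matrix.mulVec_transpose, Matrix.vecMul_add, Matrix.vecMul_smul, Matrix.vecMul_one] at hr'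
    rw [sub_smul, ← hr', add_sub_cancel_right]
  have hξh : 0 < ξ ⬝ᵥ h :=
    Finset.sum_pos (fun i _ => mul_pos (ξpos i) (hpos i)) Finset.univ_nonempty
  have hrr : r' - c = r - c := by
    have h1 := Matrix.dotProduct_mulVec ξ M h
    rw [hMh, hξM, dotProduct_smul, smul_dotProduct, smul_eq_mul, smul_eq_mul] at h1
    exact (mul_right_cancel₀ hξh.ne' h1).symm
  rw [hrr] at hξM
  have hroot : perronRoot M = r - c := by
    refine IsGreatest.csSup_eq ⟨⟨((r - c : ℝ) : ℂ), ?_, Complex.ofReal_re _⟩, ?_⟩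
    · rw [← Matrix.spectrum_toLin', ← Module.End.hasEigenvalue_iff_mem_spectrum]
      refine Module.End.hasEigenvalue_of_hasEigenvector (x := fun i => (h i : ℂ)) ⟨?_, ?_⟩
      · rw [Module.End.mem_eigenspace_iff]
        ext i
        have := congrFun hMh i
        simp only [Matrix.mulVec, dotProduct, Pi.smul_apply, smul_eq_mul] at this
        simp only [Matrix.toLin'_apply, Matrix.mulVec, dotProduct, Matrix.map_apply,
          Pi.smul_apply, smul_eq_mul]
        exact_mod_cast this
      · intro h0
        have := congrFun h0 ⟨0, hm⟩
        simp only [Pi.zero_apply, Complex.ofReal_eq_zero] at this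
        exact (hpos _).ne' this
    · rintro _ ⟨z, hz, rfl⟩
      exact re_le_of_mem_spectrum hnn ξpos hξM hz
  have hS : 0 < ∑ i, ξ i := Finset.sum_pos (fun i _ => ξpos i) Finset.univ_nonempty
  refine ⟨((∑ i, ξ i) / (ξ ⬝ᵥ h)) • h, fun i => mul_pos (div_pos hS hξh) (hpos i), ?_,
    (∑ i, ξ i)⁻¹ • ξ, ?_, ?_, ?_⟩
  · rw [Matrix.mulVec_smul, hMh, hroot, smul_comm]
  · rw [Matrix.smul_vecMul, hξM, hroot, smul_comm]
  · rw [smul_dotProduct, dotProduct_smul, smul_eq_mul, smul_eq_mul]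
    field_simp
  · simp only [Pi.smul_apply, smul_eq_mul]
    rw [← Finset.mul_sum, inv_mul_cancel₀ hS.ne']

namespace Network

variable {d m : ℕ} (N : Network d m)

lemma K_apply_ne (θ : Fin d → ℝ) {i j : Fin m} (hij : i ≠ j) : N.K θ i j = N.Q i j := by
  simp [K, Matrix.diagonal_apply_ne _ hij]

/-- Adding a diagonal matrix to `Q` changes no off-diagonal entry, so `K(θ)` is irreducible. -/
lemma K_irred (θ : Fin d → ℝ) : IsIrred (N.K θ) := fun i j => by
  induction N.Q_irred i j with
  | refl => exact .refl
  | @tail b c _ hbc ih =>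
    rcases eq_or_ne b c with rfl | h
    · exact ih
    · exact ih.tail (by rw [N.K_apply_ne θ h]; exact hbc)

lemma isPerronVec_hvec (hm : 0 < m) (θ : Fin d → ℝ) : IsPerronVec (N.K θ) (N.hvec θ) :=
  Classical.epsilon_spec (exists_isPerronVec hm
    (fun i j hij => by rw [N.K_apply_ne θ hij]; exact N.Q_nonneg i j hij) (N.K_irred θ))

lemma hvec_pos (hm : 0 < m) (θ : Fin d → ℝ) (i : Fin m) : 0 < N.hvec θ i :=
  (N.isPerronVec_hvec hm θ).1 i

lemma sum_Q_mul_hvec (hm : 0 < m) (θ : Fin d → ℝ) (i : Fin m) :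
    ∑ j, N.Q i j * N.hvec θ j + (∑ k, θ k * N.v k i) * N.hvec θ i = N.gam θ * N.hvec θ i := by
  have h := congrFun (N.isPerronVec_hvec hm θ).2.1 i
  rw [K, Matrix.add_mulVec, Pi.add_apply, Matrix.mulVec_diagonal] at h
  rw [add_comm]
  exact h

end Network

/-! ### Regularity of the sample paths -/

namespace Network

variable {d m : ℕ} (N : Network d m)

/-- The network is open: some station of each nonempty set of stations sends a positive fraction of
its releases out of the set. -/
lemma exists_sum_P_lt_one {S : Finset (Fin d)} (hS : S.Nonempty) :
    ∃ l ∈ S, ∑ k ∈ S, N.P l k < 1 := by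
  by_contra! h
  have hsplit : ∀ l, ∑ k, N.P l k = ∑ k ∈ S, N.P l k + ∑ k ∈ Sᶜ, N.P l k := fun l =>
    (Finset.sum_add_sum_compl S _).symm
  have hnn : ∀ l, 0 ≤ ∑ k ∈ Sᶜ, N.P l k := fun l => Finset.sum_nonneg fun k _ => N.P_nonneg l k
  have hzero : ∀ l ∈ S, ∀ k, k ∉ S → N.P l k ≤ 0 := fun l hl k hk => by
    have h1 : N.P l k ≤ _ := Finset.single_le_sum (f := fun k => N.P l k) (fun k _ => N.P_nonneg l k)
      (Finset.mem_compl.2 hk)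
    have h2 := hsplit l
    have h3 := h l hl
    have h4 := N.P_row l
    linarith
  obtain ⟨l, hl⟩ := hS
  have hreach : ∀ b, Relation.ReflTransGen
      (fun a b => 0 < augmentedRouting N.lam N.P a b) (some l) b → ∃ k ∈ S, b = some k := by
    intro b hb
    induction hb with
    | refl => exact ⟨l, hl, rfl⟩
    | @tail b c _ hbc ih =>
      obtain ⟨k, hk, rfl⟩ := ih
      cases c with
      | none =>
        simp only [augmentedRouting] at hbc
        linarith [hsplit k, hnn k, h k hk]
      | some c =>
        simp only [augmentedRouting] at hbc
        refine ⟨c, ?_, rfl⟩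
        by_contra hc
        exact absurd hbc (not_lt.2 (hzero k hk c hc))
  obtain ⟨k, _, hk⟩ := hreach none (N.P_irred (some l) none)
  simp at hk

/-- Release rates are nonnegative: if every station either releases at its potential rate or
releases exactly its inflow, then no release rate is negative.  The stations with a negative rate
would form a set that no fluid leaves. -/
lemma release_nonneg {x : Fin d → ℝ} {i : Fin m}
    (hx : ∀ k, x k = N.mu k i ∨ x k = N.lam k i + ∑ l, N.P l k * x l) (k : Fin d) : 0 ≤ x k := by
  by_contra! hk
  set S : Finset (Fin d) := Finset.univ.filter fun k => x k < 0 with hS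
  have hmem : ∀ l, l ∈ S ↔ x l < 0 := by simp [hS]
  obtain ⟨l₀, hl₀, hlt⟩ := N.exists_sum_P_lt_one ⟨k, (hmem k).2 hk⟩
  have h1 : ∀ k ∈ S, ∑ l ∈ S, N.P l k * x l ≤ x k := fun k hk => by
    have hk' := (hmem k).1 hk
    rcases hx k with h | h
    · exact absurd (N.mu_nonneg k i) (by rw [← h]; exact not_le.2 hk')
    · have h2 := Finset.sum_add_sum_compl S fun l => N.P l k * x l
      have h3 : 0 ≤ ∑ l ∈ Sᶜ, N.P l k * x l := Finset.sum_nonneg fun l hl =>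
        mul_nonneg (N.P_nonneg l k) (not_lt.1 fun h => Finset.mem_compl.1 hl ((hmem l).2 h))
      have h4 := N.lam_nonneg k i
      linarith
  have h2 : ∑ l ∈ S, (∑ k ∈ S, N.P l k) * x l ≤ ∑ l ∈ S, x l := by
    refine le_trans (le_of_eq ?_) (Finset.sum_le_sum h1)
    rw [Finset.sum_comm]
    exact Finset.sum_congr rfl fun l _ => Finset.sum_mul _ _ _
  have h3 : ∑ l ∈ S, x l < ∑ l ∈ S, (∑ k ∈ S, N.P l k) * x l := by
    refine Finset.sum_lt_sum (fun l hl => ?_) ⟨l₀, hl₀, ?_⟩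
    · have h4 : ∑ k ∈ S, N.P l k ≤ 1 := (Finset.sum_le_sum_of_subset_of_nonneg
        (Finset.subset_univ S) fun k _ _ => N.P_nonneg l k).trans (N.P_row l)
      nlinarith [(hmem l).1 hl]
    · nlinarith [(hmem l₀).1 hl₀]
  linarith

/-- A bound of all potential release rates. -/
noncomputable def muBound : ℝ := ∑ k, ∑ i, N.mu k i

lemma mu_le_muBound (k : Fin d) (i : Fin m) : N.mu k i ≤ N.muBound :=
  (Finset.single_le_sum (f := fun i => N.mu k i) (fun i _ => N.mu_nonneg k i)
    (Finset.mem_univ i)).trans (Finset.single_le_sum (f := fun k => ∑ i, N.mu k i)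
      (fun k _ => Finset.sum_nonneg fun i _ => N.mu_nonneg k i) (Finset.mem_univ k))

lemma muBound_nonneg : 0 ≤ N.muBound :=
  Finset.sum_nonneg fun k _ => Finset.sum_nonneg fun i _ => N.mu_nonneg k i

end Network

namespace FluidProcess

variable {d m : ℕ} {N : Network d m} {Ω : Type*} [MeasurableSpace Ω] {ℙ : Measure Ω}
  (X : FluidProcess N ℙ)

/-- The background process, extended to negative times by its initial value. -/
def bg (ω : Ω) (u : ℝ) : Fin m := X.J (max u 0) ω

/-- The process `⟨θ, Z⟩`, extended to negative times by its initial value. -/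
def lin (θ : Fin d → ℝ) (ω : Ω) (u : ℝ) : ℝ := θ ⬝ᵥ X.Z (max u 0) ω

/-- The process `Yₖ`, extended to negative times by its initial value. -/
noncomputable def extY (k : Fin d) (ω : Ω) (u : ℝ) : ℝ := X.Y k (max u 0) ω

lemma bg_of_nonneg (ω : Ω) {u : ℝ} (hu : 0 ≤ u) : X.bg ω u = X.J u ω := by
  rw [bg, max_eq_left hu]

lemma lin_of_nonneg (θ : Fin d → ℝ) (ω : Ω) {u : ℝ} (hu : 0 ≤ u) :
    X.lin θ ω u = θ ⬝ᵥ X.Z u ω := by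
  rw [lin, max_eq_left hu]

lemma extY_of_nonneg (k : Fin d) (ω : Ω) {u : ℝ} (hu : 0 ≤ u) :
    X.extY k ω u = X.Y k u ω := by
  rw [extY, max_eq_left hu]

lemma bg_right (ω : Ω) (x : ℝ) : ∀ᶠ u in 𝓝[>] x, X.bg ω u = X.bg ω x := by
  rcases lt_or_ge x 0 with h | h
  · have h1 : ∀ᶠ u in 𝓝[>] x, u < 0 := nhdsWithin_le_nhds (Iio_mem_nhds h)
    filter_upwards [h1] with u hu
    rw [bg, bg, max_eq_right hu.le, max_eq_right h.le]
  · filter_upwards [X.J_right ω x h, self_mem_nhdsWithin] with u hu hxu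
    rw [X.bg_of_nonneg ω h, X.bg_of_nonneg ω (h.trans (mem_Ioi.1 hxu).le), hu]

lemma measurable_bg (ω : Ω) : Measurable (X.bg ω) := by
  refine measurable_to_countable' fun j => MeasurableSet.of_mem_nhdsGT fun x hx => ?_
  filter_upwards [X.bg_right ω x] with u hu
  rw [mem_preimage, hu]
  exact hx

lemma measurable_comp_bg (f : Fin m → ℝ) (ω : Ω) : Measurable fun u => f (X.bg ω u) :=
  (measurable_of_countable f).comp (X.measurable_bg ω)

lemma intervalIntegrable_comp_bg (f : Fin m → ℝ) (ω : Ω) (a b : ℝ) :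
    IntervalIntegrable (fun u => f (X.bg ω u)) volume a b := by
  refine (intervalIntegrable_const (c := ∑ i, |f i|)).mono_fun
    (X.measurable_comp_bg f ω).aestronglyMeasurable (Eventually.of_forall fun u => ?_)
  refine (Finset.single_le_sum (f := fun i => |f i|) (fun i _ => abs_nonneg _)
    (Finset.mem_univ (X.bg ω u))).trans (le_abs_self _)

lemma integral_comp_bg (f : Fin m → ℝ) (ω : Ω) {t : ℝ} (ht : 0 ≤ t) :
    ∫ u in (0 : ℝ)..t, f (X.J u ω) = ∫ u in (0 : ℝ)..t, f (X.bg ω u) := by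
  refine intervalIntegral.integral_congr fun u hu => ?_
  rw [uIcc_of_le ht] at hu
  simp only [X.bg_of_nonneg ω hu.1]

/-- A positive time is regular if `J` is locally constant there and all `Bₖ` are differentiable. -/
def IsRegular (ω : Ω) (t : ℝ) : Prop :=
  (∀ᶠ u in 𝓝 t, X.bg ω u = X.bg ω t) ∧ ∀ k, DifferentiableAt ℝ (fun s => X.B s ω k) t

lemma countable_not_isRegular (ω : Ω) : {t | 0 < t ∧ ¬ X.IsRegular ω t}.Countable := by
  set D : Set ℝ := {t | 0 < t ∧ ¬ ∀ᶠ u in 𝓝 t, X.bg ω u = X.bg ω t} with hD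
  -- the jump times of `J` are isolated from the right
  have hDc : D.Countable := by
    have hiso : D ⊆ {x ∈ D | 𝓝[D ∩ Ioi x] x = ⊥} := by
      refine fun t ht => mem_sep ht ?_
      obtain ⟨b, hb, hsub⟩ := mem_nhdsGT_iff_exists_Ioo_subset.1 (X.bg_right ω t)
      rw [← empty_mem_iff_bot, mem_nhdsWithin_iff_exists_mem_nhds_inter]
      refine ⟨Iio b, Iio_mem_nhds hb, ?_⟩
      rintro u ⟨hub, hu, htu⟩
      have huI : u ∈ Ioo t b := ⟨htu, hub⟩
      refine hu.2 ?_
      filter_upwards [isOpen_Ioo.mem_nhds huI] with x hx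
      have h1 : X.bg ω x = X.bg ω t := hsub hx
      have h2 : X.bg ω u = X.bg ω t := hsub huI
      rw [h1, h2]
    exact countable_setOfPred_isolated_right_within.mono hiso
  refine (hDc.union (countable_iUnion fun k : Fin d => countable_iUnion fun n : ℕ =>
    (X.B_diff ω k n).countable)).mono ?_
  rintro t ⟨ht, hreg⟩
  rw [IsRegular, not_and_or] at hreg
  rcases hreg with h | h
  · exact Or.inl ⟨ht, h⟩
  · push Not at h
    obtain ⟨k, hk⟩ := h
    obtain ⟨n, hn⟩ := exists_nat_gt t
    exact Or.inr (mem_iUnion.2 ⟨k, mem_iUnion.2 ⟨n, ⟨ht, hn⟩, hk⟩⟩)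

lemma hasDerivAt_integral_comp_bg (f : Fin m → ℝ) {ω : Ω} {t : ℝ} (hr : X.IsRegular ω t) :
    HasDerivAt (fun s => ∫ u in (0 : ℝ)..s, f (X.bg ω u)) (f (X.bg ω t)) t := by
  refine intervalIntegral.integral_hasDerivAt_right (X.intervalIntegrable_comp_bg f ω 0 t)
    (X.measurable_comp_bg f ω).stronglyMeasurable.stronglyMeasurableAtFilter ?_
  refine (continuousAt_const (y := f (X.bg ω t))).congr ?_
  filter_upwards [hr.1] with u hu
  rw [hu]

/-- At a regular time, the release rates lie between `0` and the potential release rates. -/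
lemma deriv_B_mem {ω : Ω} {t : ℝ} (ht : 0 < t) (hr : X.IsRegular ω t) (k : Fin d) :
    0 ≤ deriv (fun s => X.B s ω k) t ∧ deriv (fun s => X.B s ω k) t ≤ N.mu k (X.bg ω t) := by
  have hbg := X.bg_of_nonneg ω ht.le
  refine ⟨N.release_nonneg (x := fun k => deriv (fun s => X.B s ω k) t) (i := X.bg ω t)
    (fun k => ?_) k, hbg ▸ X.B_le ω t ht k (hr.2 k)⟩
  rcases (X.Z_nonneg ω t ht.le k).eq_or_lt with h0 | h0
  · right
    have hZ : HasDerivAt (fun s => X.Z s ω k) (N.lam k (X.bg ω t) +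
        ∑ l, N.P l k * deriv (fun s => X.B s ω l) t - deriv (fun s => X.B s ω k) t) t := by
      have h1 : HasDerivAt (fun s => ∑ l, N.P l k * X.B s ω l)
          (∑ l, N.P l k * deriv (fun s => X.B s ω l) t) t :=
        HasDerivAt.fun_sum fun l _ => (hr.2 l).hasDerivAt.const_mul _
      have h2 := (((X.hasDerivAt_integral_comp_bg (N.lam k) hr).const_add (X.Z 0 ω k)).add
        h1).sub (hr.2 k).hasDerivAt
      refine h2.congr_of_eventuallyEq ?_
      filter_upwards [Ioi_mem_nhds ht] with s hs
      have hs' : 0 ≤ s := (mem_Ioi.1 hs).le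
      simp only [Pi.add_apply, Pi.sub_apply]
      rw [X.balance ω s hs' k, X.integral_comp_bg (N.lam k) ω hs']
    have h1 := X.Z_deriv ω t ht k hZ.differentiableAt h0.symm
    rw [hZ.deriv] at h1
    linarith
  · left
    rw [hbg]
    exact X.B_eq ω t ht k (hr.2 k) h0

lemma extY_cont (k : Fin d) (ω : Ω) : Continuous (X.extY k ω) := X.Y_cont k ω

lemma hasDerivAt_extY {ω : Ω} {t : ℝ} (ht : 0 < t) (hr : X.IsRegular ω t) (k : Fin d) :
    HasDerivAt (X.extY k ω) (N.mu k (X.bg ω t) - deriv (fun s => X.B s ω k) t) t := by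
  refine ((X.hasDerivAt_integral_comp_bg (N.mu k) hr).sub
    (hr.2 k).hasDerivAt).congr_of_eventuallyEq ?_
  filter_upwards [Ioi_mem_nhds ht] with s hs
  have hs' : 0 ≤ s := (mem_Ioi.1 hs).le
  rw [X.extY_of_nonneg k ω hs', Y, X.integral_comp_bg _ ω hs', Pi.sub_apply]

/-- Exceptional times: the origin and the positive times that are not regular. -/
def irregular (ω : Ω) : Set ℝ := insert 0 {t | 0 < t ∧ ¬ X.IsRegular ω t}

lemma countable_irregular (ω : Ω) : (X.irregular ω).Countable :=
  (X.countable_not_isRegular ω).insert 0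

lemma isRegular_of_notMem {ω : Ω} {t : ℝ} (ht : 0 < t) (h : t ∉ X.irregular ω) :
    X.IsRegular ω t := by
  by_contra hcon
  exact h (Or.inr ⟨ht, hcon⟩)

/-- Outside a countable set of times, `Yₖ` is differentiable with a derivative between `0` and a
constant. -/
lemma deriv_extY_mem {ω : Ω} {t : ℝ} (h : t ∉ X.irregular ω) (k : Fin d) :
    DifferentiableAt ℝ (X.extY k ω) t ∧ 0 ≤ deriv (X.extY k ω) t ∧
      deriv (X.extY k ω) t ≤ N.muBound := by
  rcases lt_trichotomy t 0 with ht | rfl | ht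
  · have h1 : HasDerivAt (X.extY k ω) 0 t := by
      refine (hasDerivAt_const t (X.extY k ω 0)).congr_of_eventuallyEq ?_
      filter_upwards [Iio_mem_nhds ht] with s hs
      rw [extY, extY, max_eq_right (mem_Iio.1 hs).le, max_self]
    rw [h1.deriv]
    exact ⟨h1.differentiableAt, le_rfl, N.muBound_nonneg⟩
  · exact absurd (mem_insert _ _) h
  · have hr := X.isRegular_of_notMem ht h
    have h1 := X.hasDerivAt_extY ht hr k
    have h2 := X.deriv_B_mem ht hr k
    rw [h1.deriv]
    exact ⟨h1.differentiableAt, by linarith,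
      by linarith [N.mu_le_muBound k (X.bg ω t)]⟩

lemma ae_notMem_irregular (ω : Ω) : ∀ᵐ t, t ∉ X.irregular ω :=
  (X.countable_irregular ω).ae_notMem _

/-- `Yₖ(du)` has a density, the derivative of `Yₖ`. -/
lemma dY_eq_withDensity (k : Fin d) (ω : Ω) :
    X.dY k ω = volume.withDensity fun u => ENNReal.ofReal (deriv (X.extY k ω) u) := by
  have hle : ∀ᵐ u, ENNReal.ofReal (deriv (X.extY k ω) u) ≤ ENNReal.ofReal N.muBound := by
    filter_upwards [X.ae_notMem_irregular ω] with u hu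
    exact ENNReal.ofReal_le_ofReal (X.deriv_extY_mem hu k).2.2
  have : IsLocallyFiniteMeasure (X.dY k ω) := by unfold dY; infer_instance
  refine Measure.ext_of_Ioc _ _ fun a b hab => ?_
  have hint : IntervalIntegrable (deriv (X.extY k ω)) volume a b := by
    refine (intervalIntegrable_const (c := N.muBound)).mono_fun
      (measurable_deriv _).aestronglyMeasurable (ae_restrict_of_ae ?_)
    filter_upwards [X.ae_notMem_irregular ω] with u hu
    rw [Real.norm_of_nonneg (X.deriv_extY_mem hu k).2.1, Real.norm_of_nonneg N.muBound_nonneg]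
    exact (X.deriv_extY_mem hu k).2.2
  have hftc := integral_eq_of_hasDerivAt_off_countable_of_le (X.extY k ω) (deriv (X.extY k ω))
    hab.le (X.countable_irregular ω) (X.extY_cont k ω).continuousOn
    (fun u hu => (X.deriv_extY_mem hu.2 k).1.hasDerivAt) hint
  rw [withDensity_apply _ measurableSet_Ioc, dY, StieltjesFunction.measure_Ioc]
  change ENNReal.ofReal (X.extY k ω b - X.extY k ω a) = _
  rw [← hftc, intervalIntegral.integral_of_le hab.le, ofReal_integral_eq_lintegral_ofReal]
  · exact (intervalIntegrable_iff_integrableOn_Ioc_of_le hab.le).1 hint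
  · refine ae_restrict_of_ae ?_
    filter_upwards [X.ae_notMem_irregular ω] with u hu
    exact (X.deriv_extY_mem hu k).2.1

lemma dY_le (k : Fin d) (ω : Ω) : X.dY k ω ≤ ENNReal.ofReal N.muBound • volume := by
  rw [X.dY_eq_withDensity, ← withDensity_const]
  refine withDensity_mono ?_
  filter_upwards [X.ae_notMem_irregular ω] with u hu
  exact ENNReal.ofReal_le_ofReal (X.deriv_extY_mem hu k).2.2

/-- `⟨θ, Z⟩` in terms of the free drift and the reflection terms `Yₖ`. -/
lemma lin_eq (θ : Fin d → ℝ) (ω : Ω) {t : ℝ} (ht : 0 ≤ t) :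
    X.lin θ ω t = X.lin θ ω 0 + (∫ u in (0 : ℝ)..t, ∑ k, θ k * N.v k (X.bg ω u)) +
      ∑ k, N.gamK k θ * X.extY k ω t := by
  have hmu : ∀ k, X.B t ω k = (∫ u in (0 : ℝ)..t, N.mu k (X.bg ω u)) - X.extY k ω t := fun k => by
    rw [X.extY_of_nonneg k ω ht, Y, X.integral_comp_bg _ ω ht]
    ring
  have hv : ∀ k, ∫ u in (0 : ℝ)..t, N.v k (X.bg ω u) = (∫ u in (0 : ℝ)..t, N.lam k (X.bg ω u)) +
      ∑ l, (∫ u in (0 : ℝ)..t, N.mu l (X.bg ω u)) * N.P l k -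
        ∫ u in (0 : ℝ)..t, N.mu k (X.bg ω u) := fun k => by
    have h1 := X.intervalIntegrable_comp_bg (N.lam k) ω 0 t
    have h2 : ∀ l, IntervalIntegrable (fun u => N.mu l (X.bg ω u) * N.P l k) volume 0 t :=
      fun l => (X.intervalIntegrable_comp_bg (N.mu l) ω 0 t).mul_const _
    have h3 : IntervalIntegrable (fun u => ∑ l, N.mu l (X.bg ω u) * N.P l k) volume 0 t := by
      have := IntervalIntegrable.sum Finset.univ fun l _ => h2 l
      simpa only [Finset.sum_fn] using this
    simp only [Network.v]
    rw [intervalIntegral.integral_sub (h1.add h3) (X.intervalIntegrable_comp_bg (N.mu k) ω 0 t),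
      intervalIntegral.integral_add h1 h3, intervalIntegral.integral_finsetSum fun l _ => h2 l]
    simp_rw [intervalIntegral.integral_mul_const]
  have hθ : ∫ u in (0 : ℝ)..t, ∑ k, θ k * N.v k (X.bg ω u) =
      ∑ k, θ k * ∫ u in (0 : ℝ)..t, N.v k (X.bg ω u) := by
    rw [intervalIntegral.integral_finsetSum fun k _ =>
      (X.intervalIntegrable_comp_bg (N.v k) ω 0 t).const_mul _]
    simp_rw [intervalIntegral.integral_const_mul]
  have hγ : ∑ k, N.gamK k θ * X.extY k ω t =
      ∑ k, θ k * (X.extY k ω t - ∑ l, N.P l k * X.extY l ω t) := by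
    have h1 : ∀ k, N.gamK k θ = θ k - ∑ l, θ l * N.P k l := fun k => by
      simp [Network.gamK, Network.R, Matrix.vecMul, dotProduct, mul_sub, Matrix.one_apply]
    simp_rw [h1, sub_mul, mul_sub, Finset.sum_sub_distrib, Finset.sum_mul, Finset.mul_sum]
    rw [sub_right_inj, Finset.sum_comm]
    exact Finset.sum_congr rfl fun k _ => Finset.sum_congr rfl fun l _ => by ring
  rw [hθ, hγ, X.lin_of_nonneg θ ω ht, X.lin_of_nonneg θ ω le_rfl, dotProduct, dotProduct,
    ← Finset.sum_add_distrib, ← Finset.sum_add_distrib]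
  refine Finset.sum_congr rfl fun k _ => ?_
  rw [X.balance ω t ht k, X.integral_comp_bg _ ω ht, hv k, hmu k]
  simp_rw [hmu, mul_sub, Finset.sum_sub_distrib]
  have : ∑ l, N.P l k * ∫ u in (0 : ℝ)..t, N.mu l (X.bg ω u) =
      ∑ l, (∫ u in (0 : ℝ)..t, N.mu l (X.bg ω u)) * N.P l k :=
    Finset.sum_congr rfl fun l _ => mul_comm _ _
  rw [this]
  ring

lemma lin_cont (θ : Fin d → ℝ) (ω : Ω) : Continuous (X.lin θ ω) := by
  have h1 : Continuous fun t : ℝ => X.lin θ ω 0 +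
      (∫ u in (0 : ℝ)..(max t 0), ∑ k, θ k * N.v k (X.bg ω u)) +
      ∑ k, N.gamK k θ * X.extY k ω (max t 0) := by
    refine (continuous_const.add ?_).add (continuous_finsetSum _ fun k _ =>
      continuous_const.mul ((X.extY_cont k ω).comp (by fun_prop)))
    exact (intervalIntegral.continuous_primitive (fun a b =>
      X.intervalIntegrable_comp_bg (fun i => ∑ k, θ k * N.v k i) ω a b) 0).comp (by fun_prop)
  refine h1.congr fun t => ?_
  rw [← X.lin_eq θ ω (le_max_right t 0), lin, lin, max_eq_left (le_max_right t 0)]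

/-- The change of variables formula for a smooth function of `⟨θ, Z⟩`. -/
lemma comp_lin_sub (θ : Fin d → ℝ) (ω : Ω) {g g' : ℝ → ℝ} (hg : ∀ y, HasDerivAt g (g' y) y)
    (hg' : Continuous g') {a b : ℝ} (ha : 0 ≤ a) (hab : a ≤ b) :
    g (X.lin θ ω b) - g (X.lin θ ω a) =
      (∫ u in Ioc a b, g' (X.lin θ ω u) * ∑ k, θ k * N.v k (X.bg ω u)) +
        ∑ k, N.gamK k θ * ∫ u in Ioc a b, g' (X.lin θ ω u) ∂(X.dY k ω) := by
  have hc : Continuous fun u => g' (X.lin θ ω u) := hg'.comp (X.lin_cont θ ω)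
  have hI1 : IntervalIntegrable (fun u => g' (X.lin θ ω u) * ∑ k, θ k * N.v k (X.bg ω u))
      volume a b :=
    (X.intervalIntegrable_comp_bg (fun i => ∑ k, θ k * N.v k i) ω a b).continuousOn_mul
      hc.continuousOn
  have hI2 : ∀ k, IntervalIntegrable (fun u => g' (X.lin θ ω u) * deriv (X.extY k ω) u)
      volume a b := fun k => by
    refine IntervalIntegrable.continuousOn_mul ?_ hc.continuousOn
    refine (intervalIntegrable_const (c := N.muBound)).mono_fun
      (measurable_deriv _).aestronglyMeasurable (ae_restrict_of_ae ?_)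
    filter_upwards [X.ae_notMem_irregular ω] with u hu
    rw [Real.norm_of_nonneg (X.deriv_extY_mem hu k).2.1, Real.norm_of_nonneg N.muBound_nonneg]
    exact (X.deriv_extY_mem hu k).2.2
  have hI3 : IntervalIntegrable (fun u => ∑ k, N.gamK k θ * (g' (X.lin θ ω u) *
      deriv (X.extY k ω) u)) volume a b := by
    have := IntervalIntegrable.sum Finset.univ fun k _ => (hI2 k).const_mul (N.gamK k θ)
    simpa only [Finset.sum_fn] using this
  have hftc := integral_eq_of_hasDerivAt_off_countable_of_le (fun u => g (X.lin θ ω u))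
    (fun u => g' (X.lin θ ω u) * (∑ k, θ k * N.v k (X.bg ω u)) +
      ∑ k, N.gamK k θ * (g' (X.lin θ ω u) * deriv (X.extY k ω) u))
    hab (X.countable_irregular ω)
    (Continuous.continuousOn (Continuous.comp
      (continuous_iff_continuousAt.2 fun y => (hg y).continuousAt) (X.lin_cont θ ω)))
    (fun u hu => by
      have hu0 : 0 < u := ha.trans_lt hu.1.1
      have hr := X.isRegular_of_notMem hu0 hu.2
      have hlin : HasDerivAt (X.lin θ ω) (∑ k, θ k * N.v k (X.bg ω u) +
          ∑ k, N.gamK k θ * deriv (X.extY k ω) u) u := by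
        refine (((X.hasDerivAt_integral_comp_bg (fun i => ∑ k, θ k * N.v k i) hr).const_add
          (X.lin θ ω 0)).add (HasDerivAt.fun_sum fun k _ =>
            (X.deriv_extY_mem hu.2 k).1.hasDerivAt.const_mul
              (N.gamK k θ))).congr_of_eventuallyEq ?_
        filter_upwards [Ioi_mem_nhds hu0] with s hs
        rw [X.lin_eq θ ω (mem_Ioi.1 hs).le]
        rfl
      refine ((hg _).comp u hlin).congr_deriv ?_
      rw [mul_add, Finset.mul_sum Finset.univ (fun k => N.gamK k θ * deriv (X.extY k ω) u)]
      congr 1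
      exact Finset.sum_congr rfl fun k _ => by ring)
    (hI1.add hI3)
  rw [← hftc, intervalIntegral.integral_add hI1 hI3,
    intervalIntegral.integral_finsetSum fun k _ => (hI2 k).const_mul _]
  simp_rw [intervalIntegral.integral_const_mul]
  rw [intervalIntegral.integral_of_le hab]
  congr 1
  refine Finset.sum_congr rfl fun k _ => ?_
  rw [X.dY_eq_withDensity, setIntegral_withDensity_eq_setIntegral_toReal_smul
    (measurable_deriv _).ennreal_ofReal (by simp) _ measurableSet_Ioc,
    intervalIntegral.integral_of_le hab]
  congr 1
  refine integral_congr_ae (ae_restrict_of_ae ?_)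
  filter_upwards [X.ae_notMem_irregular ω] with u hu
  rw [ENNReal.toReal_ofReal (X.deriv_extY_mem hu k).2.1, smul_eq_mul, mul_comm]

end FluidProcess

/-! ### Joint measurability and the Palm measures -/

/-- The first point of the grid `ℤ / n` at or after time `u`, for `n > 0`; the value at `n = 0` is
irrelevant. -/
noncomputable def gridUp (n : ℕ) (u : ℝ) : ℝ := (⌈(n : ℝ) * u⌉ : ℝ) / n

lemma le_gridUp {n : ℕ} (hn : 0 < n) (u : ℝ) : u ≤ gridUp n u := by
  have hn' : (0 : ℝ) < n := Nat.cast_pos.2 hn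
  rw [gridUp, le_div_iff₀ hn', mul_comm]
  exact Int.le_ceil _

lemma tendsto_gridUp (u : ℝ) : Tendsto (fun n => gridUp n u) atTop (𝓝[≥] u) := by
  refine tendsto_nhdsWithin_iff.2 ⟨?_, ?_⟩
  · have h1 : Tendsto (fun n : ℕ => u + (n : ℝ)⁻¹) atTop (𝓝 u) := by
      simpa using (tendsto_inv_atTop_nhds_zero_nat (𝕜 := ℝ)).const_add u
    refine tendsto_of_tendsto_of_tendsto_of_le_of_le' tendsto_const_nhds h1 ?_ ?_
    · filter_upwards [eventually_gt_atTop 0] with n hn using le_gridUp hn u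
    · filter_upwards [eventually_gt_atTop 0] with n hn
      have hn' : (0 : ℝ) < n := Nat.cast_pos.2 hn
      rw [gridUp, div_le_iff₀ hn', add_mul, inv_mul_cancel₀ hn'.ne', mul_comm u]
      exact (Int.ceil_lt_add_one _).le
  · filter_upwards [eventually_gt_atTop 0] with n hn using le_gridUp hn u

lemma gridUp_eq {n : ℕ} (hn : 0 < n) {i : ℕ} {u : ℝ}
    (hu : u ∈ Ioc ((i : ℝ) / n) (((i + 1 : ℕ) : ℝ) / n)) : gridUp n u = ((i + 1 : ℕ) : ℝ) / n := by
  have hn' : (0 : ℝ) < n := Nat.cast_pos.2 hn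
  have h1 := (div_lt_iff₀ hn').1 hu.1
  have h2 := (le_div_iff₀ hn').1 hu.2
  have h3 : ⌈(n : ℝ) * u⌉ = (i : ℤ) + 1 := by
    rw [Int.ceil_eq_iff]
    push_cast at h2 ⊢
    constructor <;> linarith
  rw [gridUp, h3]
  push_cast
  rfl

lemma measurable_dotProduct_fst {d m : ℕ} (θ : Fin d → ℝ) :
    Measurable fun x : (Fin d → ℝ) × Fin m => θ ⬝ᵥ x.1 := by
  simp only [dotProduct]
  exact Finset.measurable_fun_sum _ fun k _ =>
    ((measurable_pi_apply k).comp measurable_fst).const_mul _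

namespace FluidProcess

open ProbabilityTheory (Kernel IsFiniteKernel)

variable {d m : ℕ} {N : Network d m} {Ω : Type*} [MeasurableSpace Ω] {ℙ : Measure Ω}
  (X : FluidProcess N ℙ)

lemma measurable_state {t : ℝ} (ht : 0 ≤ t) : Measurable (X.state t) :=
  (X.Z_meas t ht).prodMk (X.J_meas t ht)

lemma IsStationary.integral_comp_eq {X : FluidProcess N ℙ}
    {ν : Measure ((Fin d → ℝ) × Fin m)} (hν : X.IsStationary ν) {f : (Fin d → ℝ) × Fin m → ℝ}
    (hf : Measurable f) {t : ℝ} (ht : 0 ≤ t) : ∫ ω, f (X.state t ω) ∂ℙ = ∫ x, f x ∂ν := by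
  rw [← hν t ht, integral_map (X.measurable_state ht).aemeasurable hf.aestronglyMeasurable]

lemma IsStationary.integrable_comp {X : FluidProcess N ℙ}
    {ν : Measure ((Fin d → ℝ) × Fin m)} (hν : X.IsStationary ν) {f : (Fin d → ℝ) × Fin m → ℝ}
    (hf : Integrable f ν) {t : ℝ} (ht : 0 ≤ t) : Integrable (fun ω => f (X.state t ω)) ℙ := by
  rw [← hν t ht] at hf
  exact hf.comp_measurable (X.measurable_state ht)

lemma measurable_bg_time (u : ℝ) : Measurable fun ω => X.bg ω u :=
  X.J_meas _ (le_max_right _ _)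

lemma measurable_lin_time (θ : Fin d → ℝ) (u : ℝ) : Measurable fun ω => X.lin θ ω u := by
  have h := measurable_pi_iff.1 (X.Z_meas _ (le_max_right u 0))
  simp only [lin, dotProduct]
  exact Finset.measurable_fun_sum _ fun k _ => (h k).const_mul _

lemma tendsto_bg_gridUp (ω : Ω) (u : ℝ) :
    ∀ᶠ n in atTop, X.bg ω (gridUp n u) = X.bg ω u := by
  refine (tendsto_gridUp u).eventually (p := fun x => X.bg ω x = X.bg ω u) ?_
  rw [← Ioi_insert, nhdsWithin_insert, eventually_sup]
  exact ⟨by simp, X.bg_right ω u⟩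

lemma measurable_bg_gridUp (n : ℕ) :
    Measurable fun p : Ω × ℝ => X.bg p.1 (gridUp n p.2) := by
  have h1 : Measurable fun q : Ω × ℤ => X.bg q.1 ((q.2 : ℝ) / n) :=
    measurable_from_prod_countable_left fun z => X.measurable_bg_time ((z : ℝ) / n)
  have h2 : Measurable fun p : Ω × ℝ => (p.1, ⌈(n : ℝ) * p.2⌉) :=
    measurable_fst.prodMk (Int.measurable_ceil.comp (measurable_snd.const_mul _))
  exact h1.comp h2

lemma measurable_uncurry_bg : Measurable fun p : Ω × ℝ => X.bg p.1 p.2 :=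
  measurable_of_tendsto_metrizable X.measurable_bg_gridUp (tendsto_pi_nhds.2 fun p =>
    tendsto_nhds_of_eventually_eq (X.tendsto_bg_gridUp p.1 p.2))

lemma measurable_uncurry_lin (θ : Fin d → ℝ) : Measurable fun p : Ω × ℝ => X.lin θ p.1 p.2 :=
  (measurable_uncurry_of_continuous_of_measurable (u := fun t ω => X.lin θ ω t)
    (fun ω => X.lin_cont θ ω) (X.measurable_lin_time θ)).comp measurable_swap

lemma measurable_extY_time (k : Fin d) (u : ℝ) : Measurable fun ω => X.extY k ω u := by
  have h0 := le_max_right u 0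
  have hB := measurable_pi_iff.1 (X.B_meas _ h0) k
  have hmu : StronglyMeasurable fun p : Ω × ℝ => N.mu k (X.bg p.1 p.2) :=
    ((measurable_of_countable (N.mu k)).comp X.measurable_uncurry_bg).stronglyMeasurable
  have hI : Measurable fun ω => ∫ t in (0 : ℝ)..(max u 0), N.mu k (X.bg ω t) := by
    simp_rw [intervalIntegral.integral_of_le h0]
    exact (StronglyMeasurable.integral_prod_right (f := fun ω t => N.mu k (X.bg ω t)) hmu).measurable
  have heq : (fun ω => X.extY k ω u) = fun ω =>
      (∫ t in (0 : ℝ)..(max u 0), N.mu k (X.bg ω t)) - X.B (max u 0) ω k :=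
    funext fun ω => by rw [extY, Y, X.integral_comp_bg _ ω h0]
  rw [heq]
  exact hI.sub hB

lemma dY_Ioc (k : Fin d) (ω : Ω) (a b : ℝ) :
    X.dY k ω (Ioc a b) = ENNReal.ofReal (X.extY k ω b - X.extY k ω a) := by
  rw [dY, StieltjesFunction.measure_Ioc]
  rfl

lemma dY_restrict_le (k : Fin d) (ω : Ω) : (X.dY k ω).restrict (Ioc 0 1) ≤
    ENNReal.ofReal N.muBound • volume.restrict (Ioc (0 : ℝ) 1) := by
  rw [← Measure.restrict_smul]
  exact Measure.restrict_mono_measure (X.dY_le k ω) _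

lemma dY_restrict_univ_le (k : Fin d) (ω : Ω) :
    (X.dY k ω).restrict (Ioc 0 1) univ ≤ ENNReal.ofReal N.muBound := by
  simpa using X.dY_restrict_le k ω univ

/-- The random measure `Yₖ(du)` on `(0, 1]`, as a kernel. -/
noncomputable def kernelY (k : Fin d) : Kernel Ω ℝ where
  toFun ω := (X.dY k ω).restrict (Ioc 0 1)
  measurable' := by
    have hfin : ∀ ω, IsFiniteMeasure ((X.dY k ω).restrict (Ioc 0 1)) := fun ω =>
      ⟨(X.dY_restrict_univ_le k ω).trans_lt ENNReal.ofReal_lt_top⟩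
    have hmeas : ∀ b, Measurable fun ω => X.dY k ω (Ioc 0 b) := fun b => by
      simp_rw [X.dY_Ioc]
      exact ((X.measurable_extY_time k b).sub (X.measurable_extY_time k 0)).ennreal_ofReal
    refine Measurable.measure_of_isPiSystem
      ((BorelSpace.measurable_eq (α := ℝ)).trans (borel_eq_generateFrom_Iic ℝ)) isPiSystem_Iic ?_ ?_
    · rintro _ ⟨x, rfl⟩
      have hset : Iic x ∩ Ioc 0 1 = Ioc 0 (min 1 x) := by
        ext u
        simp only [mem_Ioc, mem_inter_iff, mem_Iic, le_min_iff]
        tauto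
      simp_rw [Measure.restrict_apply measurableSet_Iic, hset]
      exact hmeas _
    · simp_rw [Measure.restrict_apply_univ]
      exact hmeas 1

lemma kernelY_apply (k : Fin d) (ω : Ω) : X.kernelY k ω = (X.dY k ω).restrict (Ioc 0 1) := rfl

instance (k : Fin d) : IsFiniteKernel (X.kernelY k) :=
  ⟨ENNReal.ofReal N.muBound, ENNReal.ofReal_lt_top, fun ω => X.dY_restrict_univ_le k ω⟩

lemma mass_eq (k : Fin d) : X.mass k = ∫⁻ ω, X.kernelY k ω univ ∂ℙ := by
  refine lintegral_congr fun ω => ?_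
  rw [kernelY_apply, Measure.restrict_apply_univ, X.dY_Ioc, X.extY_of_nonneg k ω zero_le_one,
    X.extY_of_nonneg k ω le_rfl, show X.Y k 0 ω = 0 by simp [Y, X.B_zero], sub_zero]

variable [IsProbabilityMeasure ℙ]

lemma mass_ne_top (k : Fin d) : X.mass k ≠ ⊤ := by
  rw [mass_eq]
  refine ne_top_of_le_ne_top (b := ENNReal.ofReal N.muBound) ENNReal.ofReal_ne_top ?_
  refine (lintegral_mono fun ω => X.dY_restrict_univ_le k ω).trans ?_
  simp

/-- `mₖ Eₖ(f(X))` is the integral of `f(X(u))` over the product of `ℙ` and the kernel `Yₖ(du)`.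
This includes the case `mₖ = 0`, where this product measure vanishes. -/
lemma mass_mul_palmExp (k : Fin d) {f : (Fin d → ℝ) × Fin m → ℝ≥0∞} {G : Ω × ℝ → ℝ≥0∞}
    (hG : Measurable G) (hfG : ∀ ω u, 0 ≤ u → f (X.state u ω) = G (ω, u)) :
    X.mass k * X.palmExp k f = ∫⁻ p, G p ∂(ℙ.compProd (X.kernelY k)) := by
  rw [Measure.lintegral_compProd hG, palmExp]
  have hin : ∀ ω, ∫⁻ u in Ioc (0 : ℝ) 1, f (X.state u ω) ∂(X.dY k ω) =
      ∫⁻ u, G (ω, u) ∂(X.kernelY k ω) := fun ω =>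
    setLIntegral_congr_fun measurableSet_Ioc fun u hu => hfG ω u hu.1.le
  simp_rw [hin]
  rcases eq_or_ne (X.mass k) 0 with h0 | h0
  · rw [h0, zero_mul]
    symm
    rw [mass_eq, lintegral_eq_zero_iff ((X.kernelY k).measurable_coe MeasurableSet.univ)] at h0
    rw [lintegral_eq_zero_iff hG.lintegral_kernel_prod_right']
    filter_upwards [h0] with ω hω
    rw [Measure.measure_univ_eq_zero.1 hω]
    simp
  · rw [← mul_assoc, ENNReal.mul_inv_cancel h0 (X.mass_ne_top k), one_mul]

lemma phiK_eq (k : Fin d) (θ : Fin d → ℝ) : X.phiK k θ =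
    ∫⁻ p, ENNReal.ofReal (Real.exp (X.lin θ p.1 p.2)) ∂(ℙ.compProd (X.kernelY k)) := by
  refine X.mass_mul_palmExp k
    (Real.measurable_exp.comp (X.measurable_uncurry_lin θ)).ennreal_ofReal fun ω u hu => ?_
  rw [X.lin_of_nonneg θ ω hu]
  rfl

lemma psiK_eq (k : Fin d) (θ : Fin d → ℝ) : X.psiK k θ =
    ∫⁻ p, ENNReal.ofReal (Real.exp (X.lin θ p.1 p.2) * N.hvec θ (X.bg p.1 p.2))
      ∂(ℙ.compProd (X.kernelY k)) := by
  refine X.mass_mul_palmExp k ((Real.measurable_exp.comp (X.measurable_uncurry_lin θ)).mul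
    ((measurable_of_countable (N.hvec θ)).comp X.measurable_uncurry_bg)).ennreal_ofReal
    fun ω u hu => ?_
  rw [X.lin_of_nonneg θ ω hu, X.bg_of_nonneg ω hu]
  rfl

/-! ### Stationarity -/

variable {X} {ν : Measure ((Fin d → ℝ) × Fin m)}

lemma IsStationary.isProbabilityMeasure (hν : X.IsStationary ν) : IsProbabilityMeasure ν :=
  hν 0 le_rfl ▸ Measure.isProbabilityMeasure_map (X.measurable_state le_rfl).aemeasurable

/-- Integrals over the product of `ℙ` and a kernel with density at most `c` on `(0, 1]` are
bounded by integrals over the stationary distribution. -/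
lemma IsStationary.lintegral_compProd_le (hν : X.IsStationary ν) {κ : Kernel Ω ℝ}
    [IsFiniteKernel κ] {c : ℝ≥0∞} (hκ : ∀ ω, κ ω ≤ c • volume.restrict (Ioc (0 : ℝ) 1))
    (θ : Fin d → ℝ) {f : ℝ → ℝ≥0∞} (hf : Measurable f) :
    ∫⁻ p, f (X.lin θ p.1 p.2) ∂(ℙ.compProd κ) ≤ c * ∫⁻ x, f (θ ⬝ᵥ x.1) ∂ν := by
  have hm : Measurable fun p : Ω × ℝ => f (X.lin θ p.1 p.2) :=
    hf.comp (X.measurable_uncurry_lin θ)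
  rw [Measure.lintegral_compProd hm]
  calc ∫⁻ ω, ∫⁻ u, f (X.lin θ ω u) ∂(κ ω) ∂ℙ
      ≤ ∫⁻ ω, (c * ∫⁻ u in Ioc (0 : ℝ) 1, f (X.lin θ ω u)) ∂ℙ := by
        refine lintegral_mono fun ω => ?_
        refine (lintegral_mono' (hκ ω) le_rfl).trans ?_
        rw [lintegral_smul_measure, smul_eq_mul]
    _ = c * ∫⁻ u in Ioc (0 : ℝ) 1, (∫⁻ ω, f (X.lin θ ω u) ∂ℙ) := by
        rw [lintegral_const_mul _ hm.lintegral_prod_right', lintegral_lintegral_swap hm.aemeasurable]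
    _ = c * ∫⁻ _ in Ioc (0 : ℝ) 1, (∫⁻ x, f (θ ⬝ᵥ x.1) ∂ν) := by
        congr 1
        refine setLIntegral_congr_fun measurableSet_Ioc fun u hu => ?_
        rw [← hν u hu.1.le, lintegral_map (f := fun x => f (θ ⬝ᵥ x.1))
          (hf.comp (measurable_dotProduct_fst θ)) (X.measurable_state hu.1.le)]
        refine lintegral_congr fun ω => ?_
        rw [X.lin_of_nonneg θ ω hu.1.le]
        rfl
    _ = c * ∫⁻ x, f (θ ⬝ᵥ x.1) ∂ν := by simp

end FluidProcess

/-! ### The basic adjoint relationship -/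

lemma tendsto_exp_smul_sub_one {m : ℕ} (Q : Matrix (Fin m) (Fin m) ℝ) (i j : Fin m) :
    Tendsto (fun n : ℕ => (n : ℝ) * (NormedSpace.exp ((n : ℝ)⁻¹ • Q) i j -
      (1 : Matrix (Fin m) (Fin m) ℝ) i j)) atTop (𝓝 (Q i j)) := by
  let _ : NormedRing (Matrix (Fin m) (Fin m) ℝ) := Matrix.linftyOpNormedRing
  let _ : NormedAlgebra ℝ (Matrix (Fin m) (Fin m) ℝ) := Matrix.linftyOpNormedAlgebra
  have h1 := hasDerivAt_iff_tendsto_slope_zero.1 (hasDerivAt_exp_smul_const (𝕂 := ℝ) Q (0 : ℝ))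
  rw [zero_smul, NormedSpace.exp_zero, one_mul] at h1
  have h2 : Tendsto (fun n : ℕ => ((n : ℝ)⁻¹)⁻¹ • (NormedSpace.exp ((0 + (n : ℝ)⁻¹) • Q) - 1)) atTop
      (𝓝 Q) :=
    h1.comp (tendsto_nhdsWithin_iff.2 ⟨tendsto_inv_atTop_nhds_zero_nat (𝕜 := ℝ), by
      filter_upwards [eventually_gt_atTop 0] with n hn
      simpa using hn.ne'⟩)
  have h3 := tendsto_pi_nhds.1 (tendsto_pi_nhds.1 h2 i) j
  refine h3.congr fun n => ?_
  rw [inv_inv, zero_add]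
  rfl

lemma sum_integral_grid {μ : Measure ℝ} {n : ℕ} (hn : 0 < n) {f : ℝ → ℝ}
    {F : ℕ → ℝ → ℝ} (hF : ∀ i, IntervalIntegrable (F i) μ ((i : ℝ) / n) (((i + 1 : ℕ) : ℝ) / n))
    (hf : ∀ i, EqOn f (F i) (Ioc ((i : ℝ) / n) (((i + 1 : ℕ) : ℝ) / n))) :
    ∑ i ∈ Finset.range n, ∫ u in Ioc ((i : ℝ) / n) (((i + 1 : ℕ) : ℝ) / n), F i u ∂μ =
      ∫ u in Ioc 0 1, f u ∂μ := by
  have hn' : (0 : ℝ) < n := Nat.cast_pos.2 hn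
  have hle : ∀ i : ℕ, (i : ℝ) / n ≤ ((i + 1 : ℕ) : ℝ) / n := fun i =>
    (div_le_div_iff_of_pos_right hn').2 (by push_cast; linarith)
  have h1 := intervalIntegral.sum_integral_adjacent_intervals (μ := μ) (f := f)
    (a := fun i : ℕ => (i : ℝ) / n) (n := n) fun i _ =>
      (hF i).congr (by rw [uIoc_of_le (hle i)]; exact (hf i).symm)
  simp only [Nat.cast_zero, zero_div, div_self hn'.ne'] at h1
  rw [intervalIntegral.integral_of_le zero_le_one] at h1
  rw [← h1]
  refine Finset.sum_congr rfl fun i _ => ?_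
  rw [intervalIntegral.integral_of_le (hle i)]
  exact setIntegral_congr_fun measurableSet_Ioc (hf i).symm

namespace FluidProcess

open ProbabilityTheory (Kernel IsFiniteKernel)

variable {d m : ℕ} {N : Network d m} {Ω : Type*} [MeasurableSpace Ω] {ℙ : Measure Ω}
  {X : FluidProcess N ℙ} {ν : Measure ((Fin d → ℝ) × Fin m)}

/-- Integrals of `∑ j, A i j * g j (⟨θ, z⟩)` are linear in the matrix `A`. -/
lemma integral_sum_mul (A : Matrix (Fin m) (Fin m) ℝ) (θ : Fin d → ℝ) {g : Fin m → ℝ → ℝ}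
    (hint : ∀ j, Integrable (fun x : (Fin d → ℝ) × Fin m => g j (θ ⬝ᵥ x.1)) ν) :
    ∫ x, ∑ j, A x.2 j * g j (θ ⬝ᵥ x.1) ∂ν =
      ∑ i, ∑ j, A i j * ∫ x, (Prod.snd ⁻¹' {i}).indicator (fun x => g j (θ ⬝ᵥ x.1)) x ∂ν := by
  have hm : ∀ i, MeasurableSet (Prod.snd ⁻¹' {i} : Set ((Fin d → ℝ) × Fin m)) := fun i =>
    measurable_snd (measurableSet_singleton i)
  have hi : ∀ i j, Integrable (fun x : (Fin d → ℝ) × Fin m =>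
      A i j * (Prod.snd ⁻¹' {i}).indicator (fun x => g j (θ ⬝ᵥ x.1)) x) ν := fun i j =>
    ((hint j).indicator (hm i)).const_mul _
  simp_rw [← integral_const_mul]
  rw [Finset.sum_congr rfl fun i _ => (integral_finsetSum _ fun j _ => hi i j).symm,
    ← integral_finsetSum _ fun i _ => integrable_finsetSum _ fun j _ => hi i j]
  refine integral_congr_ae (Eventually.of_forall fun x => ?_)
  symm
  simp only
  rw [Finset.sum_eq_single x.2]
  · refine Finset.sum_congr rfl fun j _ => ?_
    rw [indicator_of_mem (by simp)]
  · intro i _ hix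
    refine Finset.sum_eq_zero fun j _ => ?_
    rw [indicator_of_notMem (by simpa using hix.symm), mul_zero]
  · simp

/-- The change of `g (J, ⟨θ, Z⟩)` that is due to the changes of `Z`, along a grid. -/
lemma sum_comp_lin_sub (X : FluidProcess N ℙ) (θ : Fin d → ℝ) (ω : Ω) {g g' : Fin m → ℝ → ℝ}
    (hg : ∀ j y, HasDerivAt (g j) (g' j y) y) (hg' : ∀ j, Continuous (g' j)) {n : ℕ} (hn : 0 < n) :
    ∑ i ∈ Finset.range n, (g (X.bg ω (((i + 1 : ℕ) : ℝ) / n)) (X.lin θ ω (((i + 1 : ℕ) : ℝ) / n)) -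
        g (X.bg ω (((i + 1 : ℕ) : ℝ) / n)) (X.lin θ ω ((i : ℝ) / n))) =
      (∫ u in Ioc (0 : ℝ) 1, g' (X.bg ω (gridUp n u)) (X.lin θ ω u) *
        ∑ k, θ k * N.v k (X.bg ω u)) +
      ∑ k, N.gamK k θ * ∫ u, g' (X.bg ω (gridUp n u)) (X.lin θ ω u) ∂(X.kernelY k ω) := by
  have hn' : (0 : ℝ) < n := Nat.cast_pos.2 hn
  have hle : ∀ i : ℕ, (i : ℝ) / n ≤ ((i + 1 : ℕ) : ℝ) / n := fun i =>
    (div_le_div_iff_of_pos_right hn').2 (by push_cast; linarith)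
  have hc : ∀ j, Continuous fun u => g' j (X.lin θ ω u) := fun j => (hg' j).comp (X.lin_cont θ ω)
  have hloc : ∀ k, IsLocallyFiniteMeasure (X.dY k ω) := fun k => by unfold dY; infer_instance
  rw [Finset.sum_congr rfl fun i _ => X.comp_lin_sub θ ω (hg _) (hg' _) (by positivity) (hle i),
    Finset.sum_add_distrib, Finset.sum_comm]
  simp_rw [← Finset.mul_sum]
  congr 1
  · refine sum_integral_grid (μ := volume) hn (fun i => ?_) fun i u hu => ?_
    · exact (X.intervalIntegrable_comp_bg (fun i => ∑ k, θ k * N.v k i) ω _ _).continuousOn_mul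
        (hc _).continuousOn
    · simp only [gridUp_eq hn hu]
  · refine Finset.sum_congr rfl fun k _ => ?_
    rw [kernelY_apply]
    congr 1
    refine sum_integral_grid (μ := X.dY k ω) hn (fun i => ?_) fun i u hu => ?_
    · exact (hc _).intervalIntegrable _ _
    · simp only [gridUp_eq hn hu]

variable [IsProbabilityMeasure ℙ]

/-- The Markov property of the background process, integrated against a function of the present
buffer contents. -/
lemma IsStationary.integral_markov (hν : X.IsStationary ν) (θ : Fin d → ℝ) {g : Fin m → ℝ → ℝ}
    (hg : ∀ j, Measurable (g j))
    (hint : ∀ j, Integrable (fun x : (Fin d → ℝ) × Fin m => g j (θ ⬝ᵥ x.1)) ν)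
    {s t : ℝ} (hs : 0 ≤ s) (ht : 0 ≤ t) :
    Integrable (fun ω => g (X.J (t + s) ω) (θ ⬝ᵥ X.Z t ω)) ℙ ∧
    ∫ ω, g (X.J (t + s) ω) (θ ⬝ᵥ X.Z t ω) ∂ℙ =
      ∫ x, ∑ j, NormedSpace.exp (s • N.Q) x.2 j * g j (θ ⬝ᵥ x.1) ∂ν := by
  set E := NormedSpace.exp (s • N.Q) with hE
  have hle : history (fun u ω => (X.Z u ω, X.J u ω)) t ≤ ‹MeasurableSpace Ω› :=
    iSup₂_le fun u hu => (X.measurable_state hu.1).comap_le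
  have hstate : Measurable[history (fun u ω => (X.Z u ω, X.J u ω)) t] (X.state t) := by
    have h1 : MeasurableSpace.comap (fun ω => (X.Z t ω, X.J t ω)) inferInstance ≤
        history (fun u ω => (X.Z u ω, X.J u ω)) t :=
      le_iSup₂ (f := fun u (_ : u ∈ Icc (0 : ℝ) t) =>
        MeasurableSpace.comap (fun ω => (X.Z u ω, X.J u ω)) inferInstance) t ⟨ht, le_rfl⟩
    exact (comap_measurable (X.state t)).mono h1 le_rfl
  have hJ : ∀ j, MeasurableSet (X.J (t + s) ⁻¹' {j}) := fun j =>
    X.J_meas _ (add_nonneg ht hs) (measurableSet_singleton j)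
  set H : Fin m → Ω → ℝ := fun j ω => g j (θ ⬝ᵥ X.Z t ω) with hH
  set I : Fin m → Ω → ℝ := fun j => (X.J (t + s) ⁻¹' {j}).indicator (fun _ => (1 : ℝ)) with hI
  have hHint : ∀ j, Integrable (H j) ℙ := fun j => hν.integrable_comp (hint j) ht
  have hIint : ∀ j, Integrable (I j) ℙ := fun j => (integrable_const 1).indicator (hJ j)
  have hHI : ∀ j, H j * I j = (X.J (t + s) ⁻¹' {j}).indicator (H j) := fun j => by
    ext ω
    by_cases h : ω ∈ X.J (t + s) ⁻¹' {j} <;> simp [hI, h]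
  have hHIint : ∀ j, Integrable (H j * I j) ℙ := fun j => by
    rw [hHI]; exact (hHint j).indicator (hJ j)
  have hsum : (fun ω => g (X.J (t + s) ω) (θ ⬝ᵥ X.Z t ω)) = fun ω => ∑ j, (H j * I j) ω := by
    ext ω
    rw [Finset.sum_eq_single (X.J (t + s) ω)]
    · simp [hI, hH]
    · intro j _ hj
      simp [hI, hj.symm]
    · simp
  have hHm : ∀ j, StronglyMeasurable[history (fun u ω => (X.Z u ω, X.J u ω)) t] (H j) := fun j => by
    have h1 : Measurable fun x : (Fin d → ℝ) × Fin m => g j (θ ⬝ᵥ x.1) :=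
      (hg j).comp (measurable_dotProduct_fst θ)
    exact (h1.comp hstate).stronglyMeasurable
  have hEint : ∀ j, Integrable (fun x : (Fin d → ℝ) × Fin m => E x.2 j * g j (θ ⬝ᵥ x.1)) ν :=
    fun j => (hint j).bdd_mul (c := ∑ i, |E i j|)
      ((measurable_of_countable fun i => E i j).comp measurable_snd).aestronglyMeasurable
      (Eventually.of_forall fun x => Finset.single_le_sum (f := fun i => |E i j|)
        (fun i _ => abs_nonneg _) (Finset.mem_univ x.2))
  have hterm : ∀ j, ∫ ω, (H j * I j) ω ∂ℙ = ∫ x, E x.2 j * g j (θ ⬝ᵥ x.1) ∂ν := fun j => by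
    rw [← integral_condExp hle, integral_congr_ae
      ((condExp_mul_of_stronglyMeasurable_left (hHm j) (hHIint j) (hIint j)).trans
        ((EventuallyEq.refl _ (H j)).mul (X.J_markov s t hs ht j)))]
    rw [← hν.integral_comp_eq (f := fun x => E x.2 j * g j (θ ⬝ᵥ x.1))
      (((measurable_of_countable fun i => E i j).comp measurable_snd).mul
        ((hg j).comp (measurable_dotProduct_fst θ))) ht]
    exact integral_congr_ae (Eventually.of_forall fun ω => mul_comm _ _)
  rw [hsum]
  refine ⟨integrable_finsetSum _ fun j _ => hHIint j, ?_⟩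
  rw [integral_finsetSum _ fun j _ => hHIint j, integral_finsetSum _ fun j _ => hEint j]
  exact Finset.sum_congr rfl fun j _ => hterm j

lemma IsStationary.integrable_compProd (hν : X.IsStationary ν) {κ : Kernel Ω ℝ}
    [IsFiniteKernel κ] {c : ℝ≥0∞} (hc : c ≠ ⊤)
    (hκ : ∀ ω, κ ω ≤ c • volume.restrict (Ioc (0 : ℝ) 1))
    {θ : Fin d → ℝ} {D : ℝ → ℝ} (hD : Measurable D)
    (hint : Integrable (fun x : (Fin d → ℝ) × Fin m => D (θ ⬝ᵥ x.1)) ν) :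
    Integrable (fun p : Ω × ℝ => D (X.lin θ p.1 p.2)) (ℙ.compProd κ) := by
  refine ⟨(hD.comp (X.measurable_uncurry_lin θ)).aestronglyMeasurable, ?_⟩
  refine (hν.lintegral_compProd_le hκ θ hD.enorm).trans_lt ?_
  exact ENNReal.mul_lt_top hc.lt_top hint.2

/-- Sampling the background process at the next grid point does not change integrals in the limit
of a fine grid, by right-continuity. -/
lemma IsStationary.tendsto_integral_gridUp (hν : X.IsStationary ν) {κ : Kernel Ω ℝ}
    [IsFiniteKernel κ] {c : ℝ≥0∞} (hc : c ≠ ⊤)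
    (hκ : ∀ ω, κ ω ≤ c • volume.restrict (Ioc (0 : ℝ) 1))
    {θ : Fin d → ℝ} {D : ℝ → ℝ} (hD : Measurable D)
    (hint : Integrable (fun x : (Fin d → ℝ) × Fin m => D (θ ⬝ᵥ x.1)) ν)
    {g : Fin m → ℝ → ℝ} (hg : ∀ j, Measurable (g j)) (hgD : ∀ j y, |g j y| ≤ D y)
    (w : Fin m → ℝ) :
    (∀ n, Integrable (fun p : Ω × ℝ =>
      g (X.bg p.1 (gridUp n p.2)) (X.lin θ p.1 p.2) * w (X.bg p.1 p.2)) (ℙ.compProd κ)) ∧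
    Integrable (fun p : Ω × ℝ => g (X.bg p.1 p.2) (X.lin θ p.1 p.2) * w (X.bg p.1 p.2))
      (ℙ.compProd κ) ∧
    Tendsto (fun n => ∫ p, g (X.bg p.1 (gridUp n p.2)) (X.lin θ p.1 p.2) * w (X.bg p.1 p.2)
        ∂(ℙ.compProd κ)) atTop
      (𝓝 (∫ p, g (X.bg p.1 p.2) (X.lin θ p.1 p.2) * w (X.bg p.1 p.2) ∂(ℙ.compProd κ))) := by
  have hdom := (hν.integrable_compProd hc hκ hD hint).mul_const (∑ i, |w i|)
  have hgm : Measurable fun q : Fin m × ℝ => g q.1 q.2 :=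
    measurable_from_prod_countable_right fun j => hg j
  have hw : Measurable fun p : Ω × ℝ => w (X.bg p.1 p.2) :=
    (measurable_of_countable w).comp X.measurable_uncurry_bg
  have hbound : ∀ (i : Fin m) (p : Ω × ℝ), ‖g i (X.lin θ p.1 p.2) * w (X.bg p.1 p.2)‖ ≤
      D (X.lin θ p.1 p.2) * ∑ i, |w i| := fun i p => by
    rw [norm_mul]
    have h1 := hgD i (X.lin θ p.1 p.2)
    exact mul_le_mul h1 (Finset.single_le_sum (f := fun i => |w i|) (fun i _ => abs_nonneg _)
      (Finset.mem_univ _)) (norm_nonneg _) ((abs_nonneg _).trans h1)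
  have hmeas : ∀ n, AEStronglyMeasurable (fun p : Ω × ℝ =>
      g (X.bg p.1 (gridUp n p.2)) (X.lin θ p.1 p.2) * w (X.bg p.1 p.2)) (ℙ.compProd κ) :=
    fun n => ((hgm.comp ((X.measurable_bg_gridUp n).prodMk
      (X.measurable_uncurry_lin θ))).mul hw).aestronglyMeasurable
  refine ⟨fun n => hdom.mono' (hmeas n) (Eventually.of_forall fun p => hbound _ p),
    hdom.mono' ((hgm.comp (X.measurable_uncurry_bg.prodMk
      (X.measurable_uncurry_lin θ))).mul hw).aestronglyMeasurable
      (Eventually.of_forall fun p => hbound _ p),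
    tendsto_integral_of_dominated_convergence _ hmeas hdom
      (fun n => Eventually.of_forall fun p => hbound _ p) (Eventually.of_forall fun p => ?_)⟩
  refine tendsto_nhds_of_eventually_eq ?_
  filter_upwards [X.tendsto_bg_gridUp p.1 p.2] with n hn
  rw [hn]

lemma IsStationary.integral_time_average (hν : X.IsStationary ν) {θ : Fin d → ℝ}
    {f : ℝ → Fin m → ℝ} (hf : ∀ j, Measurable fun y => f y j)
    (hint : Integrable (fun p : Ω × ℝ => f (X.lin θ p.1 p.2) (X.bg p.1 p.2))
      (ℙ.prod (volume.restrict (Ioc (0 : ℝ) 1)))) :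
    ∫ p, f (X.lin θ p.1 p.2) (X.bg p.1 p.2) ∂(ℙ.prod (volume.restrict (Ioc (0 : ℝ) 1))) =
      ∫ x, f (θ ⬝ᵥ x.1) x.2 ∂ν := by
  have hfm : Measurable fun x : (Fin d → ℝ) × Fin m => f (θ ⬝ᵥ x.1) x.2 := by
    have h1 : Measurable fun q : ℝ × Fin m => f q.1 q.2 :=
      measurable_from_prod_countable_left fun j => hf j
    exact h1.comp ((measurable_dotProduct_fst θ).prodMk measurable_snd)
  rw [integral_prod_symm _ hint]
  have h1 : ∀ u ∈ Ioc (0 : ℝ) 1, ∫ ω, f (X.lin θ ω u) (X.bg ω u) ∂ℙ =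
      ∫ x, f (θ ⬝ᵥ x.1) x.2 ∂ν := fun u hu => by
    rw [← hν.integral_comp_eq hfm hu.1.le]
    refine integral_congr_ae (Eventually.of_forall fun ω => ?_)
    simp only [X.lin_of_nonneg θ ω hu.1.le, X.bg_of_nonneg ω hu.1.le]
    rfl
  rw [setIntegral_congr_fun measurableSet_Ioc h1]
  simp

/-- The basic adjoint relationship of the stationary distribution and the Palm measures, for test
functions `g (J, ⟨θ, Z⟩)` that are dominated, with their derivatives, by an integrable function.
It expresses that the expectation of `g (J(1), ⟨θ, Z(1)⟩) - g (J(0), ⟨θ, Z(0)⟩)` vanishes. -/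
lemma IsStationary.basic_adjoint (hν : X.IsStationary ν) {θ : Fin d → ℝ}
    {g g' : Fin m → ℝ → ℝ} {D : ℝ → ℝ} (hD : Measurable D)
    (hint : Integrable (fun x : (Fin d → ℝ) × Fin m => D (θ ⬝ᵥ x.1)) ν)
    (hg : ∀ j y, HasDerivAt (g j) (g' j y) y) (hg' : ∀ j, Continuous (g' j))
    (hgD : ∀ j y, |g j y| ≤ D y) (hgD' : ∀ j y, |g' j y| ≤ D y) :
    (∫ x, ∑ j, N.Q x.2 j * g j (θ ⬝ᵥ x.1) ∂ν) +
      (∫ x, g' x.2 (θ ⬝ᵥ x.1) * ∑ k, θ k * N.v k x.2 ∂ν) +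
      ∑ k, N.gamK k θ * ∫ p, g' (X.bg p.1 p.2) (X.lin θ p.1 p.2) ∂(ℙ.compProd (X.kernelY k))
      = 0 := by
  have hgm : ∀ j, Measurable (g j) := fun j =>
    (continuous_iff_continuousAt.2 fun y => (hg j y).continuousAt).measurable
  have hgm' : ∀ j, Measurable (g' j) := fun j => (hg' j).measurable
  have hgint : ∀ j, Integrable (fun x : (Fin d → ℝ) × Fin m => g j (θ ⬝ᵥ x.1)) ν := fun j =>
    hint.mono' ((hgm j).comp (measurable_dotProduct_fst θ)).aestronglyMeasurable
      (Eventually.of_forall fun x => hgD j _)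
  set κ₀ : Kernel Ω ℝ := Kernel.const Ω (volume.restrict (Ioc (0 : ℝ) 1)) with hκ₀
  have hprod : ℙ.compProd κ₀ = ℙ.prod (volume.restrict (Ioc (0 : ℝ) 1)) := Measure.compProd_const
  obtain ⟨hi₀, hi₀', hl₀⟩ := hν.tendsto_integral_gridUp (κ := κ₀) ENNReal.one_ne_top
    (fun ω => by simp [hκ₀]) hD hint hgm' hgD' fun i => ∑ k, θ k * N.v k i
  have hk := fun k => hν.tendsto_integral_gridUp (κ := X.kernelY k) ENNReal.ofReal_ne_top
    (X.dY_restrict_le k) hD hint hgm' hgD' fun _ => 1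
  simp only [mul_one] at hk
  -- the expected change due to the buffer contents, and its limit
  set S : ℕ → ℝ := fun n => (∫ p, g' (X.bg p.1 (gridUp n p.2)) (X.lin θ p.1 p.2) *
      (∑ k, θ k * N.v k (X.bg p.1 p.2)) ∂(ℙ.compProd κ₀)) +
    ∑ k, N.gamK k θ * ∫ p, g' (X.bg p.1 (gridUp n p.2)) (X.lin θ p.1 p.2)
      ∂(ℙ.compProd (X.kernelY k)) with hS
  have hav : ∫ p, g' (X.bg p.1 p.2) (X.lin θ p.1 p.2) * (∑ k, θ k * N.v k (X.bg p.1 p.2))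
      ∂(ℙ.compProd κ₀) = ∫ x, g' x.2 (θ ⬝ᵥ x.1) * ∑ k, θ k * N.v k x.2 ∂ν := by
    rw [hprod] at hi₀' ⊢
    exact hν.integral_time_average (f := fun y i => g' i y * ∑ k, θ k * N.v k i)
      (fun j => (hgm' j).mul_const _) hi₀'
  rw [hav] at hl₀
  have hSlim : Tendsto S atTop (𝓝 ((∫ x, g' x.2 (θ ⬝ᵥ x.1) * ∑ k, θ k * N.v k x.2 ∂ν) +
      ∑ k, N.gamK k θ * ∫ p, g' (X.bg p.1 p.2) (X.lin θ p.1 p.2)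
        ∂(ℙ.compProd (X.kernelY k)))) :=
    hl₀.add (tendsto_finsetSum Finset.univ fun k _ => (hk k).2.2.const_mul (N.gamK k θ))
  -- the expected change due to the background process, and its limit
  set T : Matrix (Fin m) (Fin m) ℝ → ℝ := fun A => ∫ x, ∑ j, A x.2 j * g j (θ ⬝ᵥ x.1) ∂ν with hT
  have hTlim : Tendsto (fun n : ℕ => (n : ℝ) * (T (NormedSpace.exp ((n : ℝ)⁻¹ • N.Q)) - T 1))
      atTop (𝓝 (T N.Q)) := by
    have h1 : ∀ n : ℕ, (n : ℝ) * (T (NormedSpace.exp ((n : ℝ)⁻¹ • N.Q)) - T 1) =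
        ∑ i, ∑ j, ((n : ℝ) * (NormedSpace.exp ((n : ℝ)⁻¹ • N.Q) i j -
          (1 : Matrix (Fin m) (Fin m) ℝ) i j)) *
          ∫ x, (Prod.snd ⁻¹' {i}).indicator (fun x => g j (θ ⬝ᵥ x.1)) x ∂ν := fun n => by
      simp only [hT, integral_sum_mul _ θ hgint]
      rw [← Finset.sum_sub_distrib, Finset.mul_sum]
      refine Finset.sum_congr rfl fun i _ => ?_
      rw [← Finset.sum_sub_distrib, Finset.mul_sum]
      exact Finset.sum_congr rfl fun j _ => by ring
    simp_rw [h1]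
    simp only [hT, integral_sum_mul _ θ hgint]
    exact tendsto_finsetSum _ fun i _ => tendsto_finsetSum _ fun j _ =>
      (tendsto_exp_smul_sub_one N.Q i j).mul_const _
  have hT1 : T 1 = ∫ x, g x.2 (θ ⬝ᵥ x.1) ∂ν := by
    refine integral_congr_ae (Eventually.of_forall fun x => ?_)
    simp [Matrix.one_apply]
  -- stationarity: the two changes cancel
  have hcancel : ∀ n : ℕ, 0 < n →
      S n = -((n : ℝ) * (T (NormedSpace.exp ((n : ℝ)⁻¹ • N.Q)) - T 1)) := fun n hn => by
    have hn' : (0 : ℝ) < n := Nat.cast_pos.2 hn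
    have hgm2 : Measurable fun x : (Fin d → ℝ) × Fin m => g x.2 (θ ⬝ᵥ x.1) := by
      have h1 : Measurable fun q : ℝ × Fin m => g q.2 q.1 :=
        measurable_from_prod_countable_left fun j => hgm j
      exact h1.comp ((measurable_dotProduct_fst θ).prodMk measurable_snd)
    have hgint2 : Integrable (fun x : (Fin d → ℝ) × Fin m => g x.2 (θ ⬝ᵥ x.1)) ν :=
      hint.mono' hgm2.aestronglyMeasurable (Eventually.of_forall fun x => hgD _ _)
    have hnext : ∀ i : ℕ, Integrable (fun ω => g (X.bg ω (((i + 1 : ℕ) : ℝ) / n))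
          (X.lin θ ω (((i + 1 : ℕ) : ℝ) / n))) ℙ ∧
        ∫ ω, g (X.bg ω (((i + 1 : ℕ) : ℝ) / n)) (X.lin θ ω (((i + 1 : ℕ) : ℝ) / n)) ∂ℙ = T 1 :=
      fun i => by
        have h0 : (0 : ℝ) ≤ ((i + 1 : ℕ) : ℝ) / n := by positivity
        simp_rw [X.bg_of_nonneg _ h0, X.lin_of_nonneg θ _ h0]
        rw [hT1]
        exact ⟨hν.integrable_comp hgint2 h0, hν.integral_comp_eq hgm2 h0⟩
    have hmark : ∀ i : ℕ, Integrable (fun ω => g (X.bg ω (((i + 1 : ℕ) : ℝ) / n))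
          (X.lin θ ω ((i : ℝ) / n))) ℙ ∧
        ∫ ω, g (X.bg ω (((i + 1 : ℕ) : ℝ) / n)) (X.lin θ ω ((i : ℝ) / n)) ∂ℙ =
          T (NormedSpace.exp ((n : ℝ)⁻¹ • N.Q)) := fun i => by
      have h0 : (0 : ℝ) ≤ (i : ℝ) / n := by positivity
      have h1 : ((i + 1 : ℕ) : ℝ) / n = (i : ℝ) / n + (n : ℝ)⁻¹ := by
        push_cast
        rw [add_div, one_div]
      have h2 : (0 : ℝ) ≤ (i : ℝ) / n + (n : ℝ)⁻¹ := by positivity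
      rw [h1]
      simp_rw [X.bg_of_nonneg _ h2, X.lin_of_nonneg θ _ h0]
      exact hν.integral_markov θ hgm hgint (by positivity) h0
    have hsub : ∀ i : ℕ, Integrable (fun ω => g (X.bg ω (((i + 1 : ℕ) : ℝ) / n))
          (X.lin θ ω (((i + 1 : ℕ) : ℝ) / n)) - g (X.bg ω (((i + 1 : ℕ) : ℝ) / n))
          (X.lin θ ω ((i : ℝ) / n))) ℙ := fun i => (hnext i).1.sub (hmark i).1
    have hsum : ∫ ω, ∑ i ∈ Finset.range n, (g (X.bg ω (((i + 1 : ℕ) : ℝ) / n))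
          (X.lin θ ω (((i + 1 : ℕ) : ℝ) / n)) - g (X.bg ω (((i + 1 : ℕ) : ℝ) / n))
          (X.lin θ ω ((i : ℝ) / n))) ∂ℙ =
        -((n : ℝ) * (T (NormedSpace.exp ((n : ℝ)⁻¹ • N.Q)) - T 1)) := by
      rw [integral_finsetSum _ fun i _ => hsub i,
        Finset.sum_congr rfl fun i _ => (integral_sub (hnext i).1 (hmark i).1).trans
          (by rw [(hnext i).2, (hmark i).2])]
      simp only [Finset.sum_const, Finset.card_range, nsmul_eq_mul]
      ring
    rw [← hsum]
    simp_rw [X.sum_comp_lin_sub θ _ hg hg' hn]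
    have e0 : Integrable (fun ω => ∫ u in Ioc (0 : ℝ) 1, g' (X.bg ω (gridUp n u)) (X.lin θ ω u) *
        ∑ k, θ k * N.v k (X.bg ω u)) ℙ := (hi₀ n).integral_compProd
    have ek : ∀ k, Integrable (fun ω => ∫ u, g' (X.bg ω (gridUp n u)) (X.lin θ ω u)
        ∂(X.kernelY k ω)) ℙ := fun k => ((hk k).1 n).integral_compProd
    rw [integral_add e0 (integrable_finsetSum _ fun k _ => (ek k).const_mul _),
      integral_finsetSum _ fun k _ => (ek k).const_mul _]
    simp_rw [integral_const_mul]
    simp only [hS]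
    congr 1
    · exact Measure.integral_compProd (hi₀ n)
    · exact Finset.sum_congr rfl fun k _ => by rw [Measure.integral_compProd ((hk k).1 n)]
  have hlim : Tendsto S atTop (𝓝 (-T N.Q)) :=
    hTlim.neg.congr' (by filter_upwards [eventually_gt_atTop 0] with n hn using (hcancel n hn).symm)
  have := tendsto_nhds_unique hlim hSlim
  simp only [hT] at this
  linarith

end FluidProcess

/-! ### Finiteness of the transforms -/

/-- Multiplying a nonnegative integrand by a factor that takes finitely many positive values does
not affect the finiteness of the integral. -/
lemma lintegral_mul_lt_top_iff {α : Type*} [MeasurableSpace α] {μ : Measure α} {m : ℕ}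
    {h : Fin m → ℝ} (hh : ∀ i, 0 < h i) {e : α → ℝ} (he : ∀ x, 0 ≤ e x) (b : α → Fin m) :
    ∫⁻ x, ENNReal.ofReal (e x) ∂μ < ⊤ ↔ ∫⁻ x, ENNReal.ofReal (e x * h (b x)) ∂μ < ⊤ := by
  have key : ∀ (f g : α → ℝ) (c : ℝ), 0 ≤ c → (∀ x, f x ≤ c * g x) →
      ∫⁻ x, ENNReal.ofReal (g x) ∂μ < ⊤ → ∫⁻ x, ENNReal.ofReal (f x) ∂μ < ⊤ := by
    intro f g c hc hfg hg
    refine (lintegral_mono fun x => (ENNReal.ofReal_le_ofReal (hfg x)).trans_eq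
      (ENNReal.ofReal_mul hc)).trans_lt ?_
    rw [lintegral_const_mul' _ _ ENNReal.ofReal_ne_top]
    exact ENNReal.mul_lt_top ENNReal.ofReal_lt_top hg
  refine ⟨key _ _ (∑ i, h i) (Finset.sum_nonneg fun i _ => (hh i).le) fun x => ?_,
    key _ _ (∑ i, (h i)⁻¹) (Finset.sum_nonneg fun i _ => (inv_pos.2 (hh i)).le) fun x => ?_⟩
  · rw [mul_comm]
    exact mul_le_mul_of_nonneg_right (Finset.single_le_sum (f := h) (fun i _ => (hh i).le)
      (Finset.mem_univ _)) (he x)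
  · have h1 : (h (b x))⁻¹ ≤ ∑ i, (h i)⁻¹ := Finset.single_le_sum (f := fun i => (h i)⁻¹)
      (fun i _ => (inv_pos.2 (hh i)).le) (Finset.mem_univ _)
    calc e x = (h (b x))⁻¹ * (e x * h (b x)) := by
          rw [mul_left_comm, inv_mul_cancel₀ (hh _).ne', mul_one]
      _ ≤ _ := mul_le_mul_of_nonneg_right h1 (mul_nonneg (he x) (hh _).le)

/-- The concave function `x ↦ N x / (N + x)` lies below its tangents. -/
lemma saturation_sub_le {N a b : ℝ} (hN : 0 < N) (ha : 0 ≤ a) (hb : 0 ≤ b) :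
    N * b / (N + b) - N * a / (N + a) ≤ (b - a) * (N ^ 2 / (N + a) ^ 2) := by
  have h1 : 0 < N + a := by linarith
  have h2 : 0 < N + b := by linarith
  have h3 : (b - a) * (N ^ 2 / (N + a) ^ 2) - (N * b / (N + b) - N * a / (N + a)) =
      N ^ 2 * (b - a) ^ 2 / ((N + a) ^ 2 * (N + b)) := by
    field_simp
    ring
  have h4 : 0 ≤ N ^ 2 * (b - a) ^ 2 / ((N + a) ^ 2 * (N + b)) := by positivity
  linarith

lemma saturation_le {N x : ℝ} (hN : 0 < N) (hx : 0 ≤ x) :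
    |N * x / (N + x)| ≤ N ∧ 0 ≤ x * (N ^ 2 / (N + x) ^ 2) ∧ |x * (N ^ 2 / (N + x) ^ 2)| ≤ N ∧
      x * (N ^ 2 / (N + x) ^ 2) ≤ x := by
  have h1 : 0 < N + x := by linarith
  have h2 : 0 ≤ x * (N ^ 2 / (N + x) ^ 2) := by positivity
  refine ⟨?_, h2, ?_, ?_⟩
  · rw [abs_of_nonneg (by positivity), div_le_iff₀ h1]
    nlinarith
  · rw [abs_of_nonneg h2, mul_div_assoc', div_le_iff₀ (by positivity)]
    have : 0 ≤ N * (N ^ 2 + N * x + x ^ 2) := by positivity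
    nlinarith
  · refine mul_le_of_le_one_right hx ((div_le_one (by positivity)).2 ?_)
    exact pow_le_pow_left₀ hN.le (by linarith) 2

lemma hasDerivAt_saturation {N h y : ℝ} (hN : 0 < N) (hh : 0 < h) :
    HasDerivAt (fun y => N * (Real.exp y * h) / (N + Real.exp y * h))
      (Real.exp y * h * (N ^ 2 / (N + Real.exp y * h) ^ 2)) y := by
  have h1 : HasDerivAt (fun y => Real.exp y * h) (Real.exp y * h) y :=
    (Real.hasDerivAt_exp y).mul_const h
  have h2 : N + Real.exp y * h ≠ 0 := by positivity
  refine ((h1.const_mul N).div (h1.const_add N) h2).congr_deriv ?_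
  field_simp
  ring

lemma tendsto_saturation (x : ℝ) :
    Tendsto (fun n : ℕ => x * (((n : ℝ) + 1) ^ 2 / ((n : ℝ) + 1 + x) ^ 2)) atTop (𝓝 x) := by
  have h1 : Tendsto (fun n : ℕ => (n : ℝ) + 1 + x) atTop atTop :=
    tendsto_atTop_add_const_right _ _
      (tendsto_atTop_add_const_right _ _ tendsto_natCast_atTop_atTop)
  have h2 : Tendsto (fun n : ℕ => x * (1 - x * ((n : ℝ) + 1 + x)⁻¹) ^ 2) atTop
      (𝓝 (x * (1 - x * 0) ^ 2)) :=
    ((tendsto_const_nhds.sub (h1.inv_tendsto_atTop.const_mul x)).pow 2).const_mul x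
  simp only [mul_zero, sub_zero, one_pow, mul_one] at h2
  refine h2.congr' ?_
  filter_upwards [h1.eventually_gt_atTop 0] with n hn
  rw [← div_pow]
  congr 2
  field_simp
  ring

lemma coe_toReal_of_ne_top {x : ℝ≥0∞} (hx : x ≠ ⊤) : (x : EReal) = ((x.toReal : ℝ) : EReal) := by
  lift x to NNReal using hx
  rfl

lemma ereal_coe_sum {ι : Type*} (s : Finset ι) (f : ι → ℝ) :
    ((∑ i ∈ s, f i : ℝ) : EReal) = ∑ i ∈ s, (f i : EReal) :=
  map_sum (⟨⟨Real.toEReal, EReal.coe_zero⟩, EReal.coe_add⟩ : ℝ →+ EReal) f s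

namespace FluidProcess

variable {d m : ℕ} {N : Network d m} {Ω : Type*} [MeasurableSpace Ω] {ℙ : Measure Ω}
  {X : FluidProcess N ℙ} {ν : Measure ((Fin d → ℝ) × Fin m)}

lemma measurable_exp_mul_hvec (θ : Fin d → ℝ) :
    Measurable fun x : (Fin d → ℝ) × Fin m => Real.exp (θ ⬝ᵥ x.1) * N.hvec θ x.2 :=
  (Real.measurable_exp.comp (measurable_dotProduct_fst θ)).mul
    ((measurable_of_countable (N.hvec θ)).comp measurable_snd)

lemma measurable_exp_lin_mul_hvec (X : FluidProcess N ℙ) (θ : Fin d → ℝ) :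
    Measurable fun p : Ω × ℝ => Real.exp (X.lin θ p.1 p.2) * N.hvec θ (X.bg p.1 p.2) :=
  (Real.measurable_exp.comp (X.measurable_uncurry_lin θ)).mul
    ((measurable_of_countable (N.hvec θ)).comp X.measurable_uncurry_bg)

lemma phi_lt_top_iff (hm : 0 < m) (θ : Fin d → ℝ) : phi ν θ < ⊤ ↔ psi N ν θ < ⊤ :=
  lintegral_mul_lt_top_iff (N.hvec_pos hm θ) (fun _ => (Real.exp_pos _).le) _

lemma toReal_psi (hm : 0 < m) (θ : Fin d → ℝ) :
    (psi N ν θ).toReal = ∫ x, Real.exp (θ ⬝ᵥ x.1) * N.hvec θ x.2 ∂ν := by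
  rw [integral_eq_lintegral_of_nonneg_ae (Eventually.of_forall fun x =>
    mul_nonneg (Real.exp_pos _).le (N.hvec_pos hm θ _).le)
    (measurable_exp_mul_hvec θ).aestronglyMeasurable, psi]

/-- The drift of the saturation `c F / (c + F)` of `F = e^{⟨θ, Z⟩} h_θ(J)` is at most `γ(θ)` times
its derivative in `⟨θ, Z⟩`, since saturation is concave. -/
lemma drift_saturation_le (N : Network d m) (hm : 0 < m) (θ : Fin d → ℝ) {c : ℝ} (hc : 0 < c)
    (i : Fin m) (y : ℝ) :
    ∑ j, N.Q i j * (c * (Real.exp y * N.hvec θ j) / (c + Real.exp y * N.hvec θ j)) +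
      Real.exp y * N.hvec θ i * (c ^ 2 / (c + Real.exp y * N.hvec θ i) ^ 2) *
        ∑ k, θ k * N.v k i ≤
      N.gam θ * (Real.exp y * N.hvec θ i * (c ^ 2 / (c + Real.exp y * N.hvec θ i) ^ 2)) := by
  set F : Fin m → ℝ := fun j => Real.exp y * N.hvec θ j with hF
  have hF0 : ∀ j, 0 ≤ F j := fun j => mul_nonneg (Real.exp_pos _).le (N.hvec_pos hm θ j).le
  set q := c ^ 2 / (c + F i) ^ 2 with hq
  have hrow : ∀ a : ℝ, ∑ j, N.Q i j * a = 0 := fun a => by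
    rw [← Finset.sum_mul, N.Q_row, zero_mul]
  have h1 : ∑ j, N.Q i j * (c * F j / (c + F j)) ≤ ∑ j, N.Q i j * (F j * q) := by
    have h2 : ∑ j, N.Q i j * (c * F j / (c + F j) - c * F i / (c + F i)) ≤
        ∑ j, N.Q i j * ((F j - F i) * q) := Finset.sum_le_sum fun j _ => by
      rcases eq_or_ne i j with rfl | hij
      · simp
      · exact mul_le_mul_of_nonneg_left (saturation_sub_le hc (hF0 i) (hF0 j))
          (N.Q_nonneg i j hij)
    simp only [mul_sub, sub_mul, Finset.sum_sub_distrib] at h2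
    rw [hrow, hrow] at h2
    linarith
  have h3 : ∑ j, N.Q i j * (F j * q) + F i * q * ∑ k, θ k * N.v k i = N.gam θ * (F i * q) := by
    have h4 : ∑ j, N.Q i j * (F j * q) = Real.exp y * q * ∑ j, N.Q i j * N.hvec θ j := by
      rw [Finset.mul_sum]
      exact Finset.sum_congr rfl fun j _ => by simp only [hF]; ring
    have h5 := N.sum_Q_mul_hvec hm θ i
    rw [h4]
    simp only [hF]
    linear_combination Real.exp y * q * h5
  change ∑ j, N.Q i j * (c * F j / (c + F j)) + F i * q * ∑ k, θ k * N.v k i ≤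
    N.gam θ * (F i * q)
  linarith

variable [IsProbabilityMeasure ℙ]

lemma phiK_lt_top_iff (hm : 0 < m) (θ : Fin d → ℝ) (k : Fin d) :
    X.phiK k θ < ⊤ ↔ X.psiK k θ < ⊤ := by
  rw [phiK_eq, psiK_eq]
  exact lintegral_mul_lt_top_iff (N.hvec_pos hm θ) (fun _ => (Real.exp_pos _).le) _

lemma toReal_psiK (hm : 0 < m) (θ : Fin d → ℝ) (k : Fin d) :
    (X.psiK k θ).toReal = ∫ p, Real.exp (X.lin θ p.1 p.2) * N.hvec θ (X.bg p.1 p.2)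
      ∂(ℙ.compProd (X.kernelY k)) := by
  rw [integral_eq_lintegral_of_nonneg_ae (Eventually.of_forall fun p =>
    mul_nonneg (Real.exp_pos _).le (N.hvec_pos hm θ _).le)
    (X.measurable_exp_lin_mul_hvec θ).aestronglyMeasurable, psiK_eq]

lemma IsStationary.phiK_lt_top (hν : X.IsStationary ν) {θ : Fin d → ℝ} (hφ : phi ν θ < ⊤)
    (k : Fin d) : X.phiK k θ < ⊤ := by
  rw [phiK_eq]
  refine (hν.lintegral_compProd_le (X.dY_restrict_le k) θ
    (f := fun y => ENNReal.ofReal (Real.exp y)) (by fun_prop)).trans_lt ?_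
  exact ENNReal.mul_lt_top ENNReal.ofReal_lt_top hφ

/-- The key relation between the transforms: the basic adjoint relationship for
`e^{⟨θ, Z⟩} h_θ(J)`. -/
lemma IsStationary.key_relation (hν : X.IsStationary ν) (hm : 0 < m) {θ : Fin d → ℝ}
    (hφ : phi ν θ < ⊤) :
    N.gam θ * (psi N ν θ).toReal + ∑ k, N.gamK k θ * (X.psiK k θ).toReal = 0 := by
  have hexp : Integrable (fun x : (Fin d → ℝ) × Fin m => Real.exp (θ ⬝ᵥ x.1)) ν := by
    refine ⟨(Real.measurable_exp.comp (measurable_dotProduct_fst θ)).aestronglyMeasurable, ?_⟩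
    rw [hasFiniteIntegral_iff_ofReal (Eventually.of_forall fun x => (Real.exp_pos _).le)]
    exact hφ
  have hle : ∀ j, N.hvec θ j ≤ ∑ i, N.hvec θ i := fun j =>
    Finset.single_le_sum (f := N.hvec θ) (fun i _ => (N.hvec_pos hm θ i).le) (Finset.mem_univ j)
  have hbd : ∀ j y, |Real.exp y * N.hvec θ j| ≤ Real.exp y * ∑ i, N.hvec θ i := fun j y => by
    rw [abs_of_nonneg (mul_nonneg (Real.exp_pos _).le (N.hvec_pos hm θ _).le)]
    exact mul_le_mul_of_nonneg_left (hle j) (Real.exp_pos _).le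
  have h := hν.basic_adjoint (θ := θ) (D := fun y => Real.exp y * ∑ i, N.hvec θ i)
    (g := fun j y => Real.exp y * N.hvec θ j) (g' := fun j y => Real.exp y * N.hvec θ j)
    (by fun_prop) (hexp.mul_const _) (fun j y => (Real.hasDerivAt_exp y).mul_const _)
    (fun j => by fun_prop) hbd hbd
  have hQ : ∀ x : (Fin d → ℝ) × Fin m,
      ∑ j, N.Q x.2 j * (Real.exp (θ ⬝ᵥ x.1) * N.hvec θ j) =
        Real.exp (θ ⬝ᵥ x.1) * ∑ j, N.Q x.2 j * N.hvec θ j := fun x => by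
    rw [Finset.mul_sum]
    exact Finset.sum_congr rfl fun j _ => by ring
  have hfin : ∀ f : Fin m → ℝ,
      Integrable (fun x : (Fin d → ℝ) × Fin m => Real.exp (θ ⬝ᵥ x.1) * f x.2) ν := fun f =>
    hexp.mul_bdd (c := ∑ i, |f i|) ((measurable_of_countable f).comp
      measurable_snd).aestronglyMeasurable (Eventually.of_forall fun x =>
        Finset.single_le_sum (f := fun i => |f i|) (fun i _ => abs_nonneg _)
          (Finset.mem_univ x.2))
  rw [toReal_psi hm, ← integral_const_mul]
  simp_rw [toReal_psiK hm]
  rw [← h]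
  congr 1
  simp_rw [hQ, mul_assoc]
  rw [← integral_add (hfin fun i => ∑ j, N.Q i j * N.hvec θ j)
    (hfin fun i => N.hvec θ i * ∑ k, θ k * N.v k i)]
  refine integral_congr_ae (Eventually.of_forall fun x => ?_)
  have := N.sum_Q_mul_hvec hm θ x.2
  simp only
  rw [← mul_add, mul_comm (N.hvec θ x.2), this]
  ring

/-- If `γ(θ) < 0`, and `φₖ(θ)` is finite unless `γₖ(θ) < 0`, then `φ(θ)` is finite.
The saturated functions `c F / (c + F)` of `F = e^{⟨θ, Z⟩} h_θ(J)` are bounded, so that the basic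
adjoint relationship applies to them; it yields a bound that is uniform in `c`. -/
lemma IsStationary.phi_lt_top (hν : X.IsStationary ν) (hm : 0 < m) {θ : Fin d → ℝ}
    {A : Finset (Fin d)} (hγ : N.gam θ < 0) (hγk : ∀ k ∉ A, N.gamK k θ < 0)
    (hA : ∀ k ∈ A, X.phiK k θ < ⊤) : phi ν θ < ⊤ := by
  have hprob := hν.isProbabilityMeasure
  have hh := N.hvec_pos hm θ
  have hFpos : ∀ (j : Fin m) (y : ℝ), 0 ≤ Real.exp y * N.hvec θ j := fun j y =>
    mul_nonneg (Real.exp_pos _).le (hh j).le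
  -- the derivative of the saturated function in the variable `y = ⟨θ, z⟩`
  set G : ℝ → Fin m → ℝ → ℝ := fun c j y =>
    Real.exp y * N.hvec θ j * (c ^ 2 / (c + Real.exp y * N.hvec θ j) ^ 2) with hG
  have hGc : ∀ c, 0 < c → ∀ j, Continuous (G c j) := fun c hc j => by
    have : ∀ y, (c + Real.exp y * N.hvec θ j) ^ 2 ≠ 0 := fun y =>
      (pow_pos (add_pos_of_pos_of_nonneg hc (hFpos j y)) 2).ne'
    simp only [hG]
    fun_prop (disch := assumption)
  have hGm : ∀ c, 0 < c → Measurable fun q : Fin m × ℝ => G c q.1 q.2 := fun c hc =>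
    measurable_from_prod_countable_right fun j => (hGc c hc j).measurable
  have hGν : ∀ c, 0 < c → Measurable fun x : (Fin d → ℝ) × Fin m => G c x.2 (θ ⬝ᵥ x.1) :=
    fun c hc => (hGm c hc).comp (measurable_snd.prodMk (measurable_dotProduct_fst θ))
  have hGM : ∀ c, 0 < c → Measurable fun p : Ω × ℝ => G c (X.bg p.1 p.2) (X.lin θ p.1 p.2) :=
    fun c hc => (hGm c hc).comp (X.measurable_uncurry_bg.prodMk (X.measurable_uncurry_lin θ))
  have hGint : ∀ c, 0 < c → Integrable (fun x : (Fin d → ℝ) × Fin m => G c x.2 (θ ⬝ᵥ x.1)) ν :=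
    fun c hc => (integrable_const c).mono' (hGν c hc).aestronglyMeasurable
      (Eventually.of_forall fun x => (saturation_le hc (hFpos _ _)).2.2.1)
  set C : ℝ := ∑ k ∈ A, |N.gamK k θ| * (X.psiK k θ).toReal with hC
  have hmain : ∀ c, 0 < c → ∫ x, G c x.2 (θ ⬝ᵥ x.1) ∂ν ≤ C / (-N.gam θ) := fun c hc => by
    have hbar := hν.basic_adjoint (θ := θ) (D := fun _ => c)
      (g := fun j y => c * (Real.exp y * N.hvec θ j) / (c + Real.exp y * N.hvec θ j))
      (g' := G c) measurable_const (integrable_const c)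
      (fun j y => hasDerivAt_saturation hc (hh j)) (hGc c hc)
      (fun j y => (saturation_le hc (hFpos j y)).1)
      (fun j y => (saturation_le hc (hFpos j y)).2.2.1)
    have hi1 : Integrable (fun x : (Fin d → ℝ) × Fin m => ∑ j, N.Q x.2 j *
        (c * (Real.exp (θ ⬝ᵥ x.1) * N.hvec θ j) / (c + Real.exp (θ ⬝ᵥ x.1) * N.hvec θ j))) ν := by
      refine integrable_finsetSum _ fun j _ => ?_
      refine Integrable.bdd_mul (c := ∑ i, |N.Q i j|) ?_
        ((measurable_of_countable fun i => N.Q i j).comp measurable_snd).aestronglyMeasurable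
        (Eventually.of_forall fun x => Finset.single_le_sum (f := fun i => |N.Q i j|)
          (fun i _ => abs_nonneg _) (Finset.mem_univ x.2))
      refine (integrable_const c).mono' (Measurable.aestronglyMeasurable ?_)
        (Eventually.of_forall fun x => (saturation_le hc (hFpos _ _)).1)
      have := measurable_dotProduct_fst (m := m) θ
      fun_prop
    have hi2 : Integrable (fun x : (Fin d → ℝ) × Fin m =>
        G c x.2 (θ ⬝ᵥ x.1) * ∑ k, θ k * N.v k x.2) ν :=
      (hGint c hc).mul_bdd (c := ∑ i, |∑ k, θ k * N.v k i|)
        ((measurable_of_countable fun i => ∑ k, θ k * N.v k i).comp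
          measurable_snd).aestronglyMeasurable
        (Eventually.of_forall fun x => Finset.single_le_sum
          (f := fun i => |∑ k, θ k * N.v k i|) (fun i _ => abs_nonneg _) (Finset.mem_univ x.2))
    have hdrift : (∫ x, ∑ j, N.Q x.2 j * (c * (Real.exp (θ ⬝ᵥ x.1) * N.hvec θ j) /
          (c + Real.exp (θ ⬝ᵥ x.1) * N.hvec θ j)) ∂ν) +
        (∫ x, G c x.2 (θ ⬝ᵥ x.1) * ∑ k, θ k * N.v k x.2 ∂ν) ≤
        N.gam θ * ∫ x, G c x.2 (θ ⬝ᵥ x.1) ∂ν := by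
      rw [← integral_add hi1 hi2, ← integral_const_mul]
      exact integral_mono (hi1.add hi2) ((hGint c hc).const_mul _) fun x =>
        drift_saturation_le N hm θ hc x.2 (θ ⬝ᵥ x.1)
    have hbdry : ∑ k, N.gamK k θ *
          ∫ p, G c (X.bg p.1 p.2) (X.lin θ p.1 p.2) ∂(ℙ.compProd (X.kernelY k)) ≤ C := by
      have h0 : ∀ k, 0 ≤ ∫ p, G c (X.bg p.1 p.2) (X.lin θ p.1 p.2)
          ∂(ℙ.compProd (X.kernelY k)) := fun k =>
        integral_nonneg fun p => (saturation_le hc (hFpos _ _)).2.1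
      rw [← Finset.sum_add_sum_compl A]
      have h1 : ∑ k ∈ Aᶜ, N.gamK k θ *
          ∫ p, G c (X.bg p.1 p.2) (X.lin θ p.1 p.2) ∂(ℙ.compProd (X.kernelY k)) ≤ 0 :=
        Finset.sum_nonpos fun k hk =>
          mul_nonpos_of_nonpos_of_nonneg (hγk k (Finset.mem_compl.1 hk)).le (h0 k)
      have h2 : ∑ k ∈ A, N.gamK k θ *
          ∫ p, G c (X.bg p.1 p.2) (X.lin θ p.1 p.2) ∂(ℙ.compProd (X.kernelY k)) ≤ C := by
        refine Finset.sum_le_sum fun k hk => ?_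
        refine mul_le_mul (le_abs_self _) ?_ (h0 k) (abs_nonneg _)
        rw [toReal_psiK hm]
        have hψ := (phiK_lt_top_iff hm θ k).1 (hA k hk)
        rw [psiK_eq] at hψ
        refine integral_mono_of_nonneg (Eventually.of_forall fun p =>
          (saturation_le hc (hFpos _ _)).2.1) ⟨?_, ?_⟩ (Eventually.of_forall fun p =>
          (saturation_le hc (hFpos _ _)).2.2.2)
        · exact (X.measurable_exp_lin_mul_hvec θ).aestronglyMeasurable
        · rwa [hasFiniteIntegral_iff_ofReal (Eventually.of_forall fun p => hFpos _ _)]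
      linarith
    rw [le_div_iff₀ (neg_pos.2 hγ)]
    linarith
  rw [phi_lt_top_iff (N := N) hm]
  -- Fatou's lemma along the saturation levels `c = n + 1`
  have hfatou : psi N ν θ ≤ ENNReal.ofReal (C / (-N.gam θ)) := by
    have hpos : ∀ n : ℕ, (0 : ℝ) < (n : ℝ) + 1 := fun n => by positivity
    calc psi N ν θ = ∫⁻ x, liminf (fun n : ℕ =>
          ENNReal.ofReal (G ((n : ℝ) + 1) x.2 (θ ⬝ᵥ x.1))) atTop ∂ν :=
          lintegral_congr fun x =>
            ((ENNReal.continuous_ofReal.tendsto _).comp (tendsto_saturation _)).liminf_eq.symm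
      _ ≤ liminf (fun n : ℕ => ∫⁻ x, ENNReal.ofReal (G ((n : ℝ) + 1) x.2 (θ ⬝ᵥ x.1)) ∂ν) atTop :=
          lintegral_liminf_le fun n => (hGν _ (hpos n)).ennreal_ofReal
      _ ≤ ENNReal.ofReal (C / (-N.gam θ)) := by
          refine liminf_le_of_frequently_le' (Frequently.of_forall fun n => ?_)
          rw [← ofReal_integral_eq_lintegral_ofReal (hGint _ (hpos n))
            (Eventually.of_forall fun x => (saturation_le (hpos n) (hFpos _ _)).2.1)]
          exact ENNReal.ofReal_le_ofReal (hmain _ (hpos n))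
  exact hfatou.trans_lt ENNReal.ofReal_lt_top

end FluidProcess

end MMFN

theorem lemma4p2 {d m : ℕ} (hd : 2 ≤ d) (hm : 2 ≤ m) (N : MMFN.Network d m)
    {Ω : Type*} [MeasurableSpace Ω] (ℙ : Measure Ω) [IsProbabilityMeasure ℙ]
    (X : MMFN.FluidProcess N ℙ) (ν : Measure ((Fin d → ℝ) × Fin m)) (hν : X.IsStationary ν)
    (θ : Fin d → ℝ) :
    -- the two kinds of transforms are finite together
    (MMFN.phi ν θ < ⊤ ↔ MMFN.psi N ν θ < ⊤) ∧
    (∀ k, X.phiK k θ < ⊤ ↔ X.psiK k θ < ⊤) ∧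
    -- part (a)
    (MMFN.phi ν θ < ⊤ →
      (∀ k, X.phiK k θ < ⊤ ∧ X.psiK k θ < ⊤) ∧
      N.gam θ * (MMFN.psi N ν θ).toReal + ∑ k, N.gamK k θ * (X.psiK k θ).toReal = 0) ∧
    -- part (b)
    (∀ A : Finset (Fin d), θ ∈ N.GammaMinus Aᶜ → (∀ k ∈ A, X.phiK k θ < ⊤) →
      ((-N.gam θ : ℝ) : EReal) * (MMFN.psi N ν θ : EReal)
          + ∑ k ∈ Aᶜ, ((-N.gamK k θ : ℝ) : EReal) * (X.psiK k θ : EReal)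
        ≤ ∑ k ∈ A, ((N.gamK k θ : ℝ) : EReal) * (X.psiK k θ : EReal) ∧
      MMFN.phi ν θ < ⊤ ∧ MMFN.psi N ν θ < ⊤ ∧
      (∀ k ∈ Aᶜ, X.phiK k θ < ⊤ ∧ X.psiK k θ < ⊤) ∧
      N.gam θ * (MMFN.psi N ν θ).toReal + ∑ k, N.gamK k θ * (X.psiK k θ).toReal = 0) := by
  have hm0 : 0 < m := by omega
  refine ⟨MMFN.FluidProcess.phi_lt_top_iff hm0 θ, MMFN.FluidProcess.phiK_lt_top_iff hm0 θ,
    fun hφ => ⟨fun k => ?_, hν.key_relation hm0 hφ⟩, fun A hθ hA => ?_⟩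
  · have h1 := hν.phiK_lt_top hφ k
    exact ⟨h1, (MMFN.FluidProcess.phiK_lt_top_iff hm0 θ k).1 h1⟩
  · have hφ : MMFN.phi ν θ < ⊤ := hν.phi_lt_top hm0 hθ.1
      (fun k hk => hθ.2 k (Finset.mem_compl.2 hk)) hA
    have hψ := (MMFN.FluidProcess.phi_lt_top_iff (N := N) hm0 θ).1 hφ
    have hφk := hν.phiK_lt_top hφ
    have hψk := fun k => (MMFN.FluidProcess.phiK_lt_top_iff hm0 θ k).1 (hφk k)
    have hkey := hν.key_relation hm0 hφ
    refine ⟨?_, hφ, hψ, fun k _ => ⟨hφk k, hψk k⟩, hkey⟩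
    rw [MMFN.coe_toReal_of_ne_top hψ.ne]
    simp_rw [fun k => MMFN.coe_toReal_of_ne_top (hψk k).ne, ← EReal.coe_mul]
    rw [← MMFN.ereal_coe_sum, ← MMFN.ereal_coe_sum, ← EReal.coe_add, EReal.coe_le_coe_iff]
    rw [← Finset.sum_add_sum_compl A] at hkey
    simp only [neg_mul, Finset.sum_neg_distrib]
    linarith
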